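/- Let $G$ be a Carnot group of step $2$ and of topological dimension $n\le 7$, i.e. a connected and simply connected Lie group whose Lie algebra is finite-dimensional, real and stratified of step $2$: $\mathfrak g=V_1\oplus V_2$ with $[V_1,V_1]=V_2\neq\{0\}$ and $[V_2,V_1]=\{0\}$. Through the exponential map, $G$ is identified with the vector space $\mathfrak g$ with the product $x\ast y=x+y+\tfrac12[x,y]$ and the identity $e=0$. For a control $u\in L^2([0,1],V_1)$ let $\gamma_u:[0,1]\to G$ be the absolutely continuous curve with $\gamma_u(0)=e$ and $\dot\gamma_u(t)=(\mathrm dL_{\gamma_u(t)})_e\,u(t)$ for almost every $t$, where $L_g$ is the left translation by $g$, and let $\mathrm{End}:L^2([0,1],V_1)\to G$, $\mathrm{End}(u)=\gamma_u(1)$, be the endpoint map. Let $$\mathrm{Abn}_G=\{\gamma_u(1)\;:\;u\in L^2([0,1],V_1),\ \mathrm{Im}(\mathrm d\,\mathrm{End}_u)\subsetneq T_{\gamma_u(1)}G\}$$ be the abnormal set of $G$, i.e. the set of critical values of $\mathrm{End}$. Then $\mathrm{Abn}_G$ is contained in a real algebraic subvariety of $G$ of codimension at least three: for every system of exponential coordinates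 $G\cong\mathbb R^n$ given by a basis of $\mathfrak g$, there is an algebraic set $Z\subseteq\mathbb R^n$ (the set of common zeros of a family of real polynomials, possibly reducible) with $\mathrm{Abn}_G\subseteq Z$ and $\dim Z\le n-3$, where $\dim Z$ is the Krull dimension of $\mathbb R[x_1,\dots,x_n]/I(Z)$ and $I(Z)$ is the ideal of the polynomials vanishing on $Z$. -/

import Mathlib

open MeasureTheory Set
open scoped Manifold ContDiff

/-- A real Lie algebra together with an auxiliary norm on its underlying vector space (compatible
with the vector space operations; nothing is required of the bracket).  In finite dimension the norm
is only used to speak about the canonical topology, derivatives and `L²` functions. -/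
class NormedRealLieAlgebra (g : Type*) extends
  NormedAddCommGroup g, LieRing g, NormedSpace ℝ g, LieAlgebra ℝ g

/-- A step-2 stratification `g = V₁ ⊕ V₂` of a real Lie algebra: `[V₁, V₁] = V₂`, `V₂ ≠ 0` and
`[V₂, V₁] = 0`. -/
structure StepTwoStratification (g : Type*) [LieRing g] [LieAlgebra ℝ g] where
  V₁ : Submodule ℝ g
  V₂ : Submodule ℝ g
  isCompl : IsCompl V₁ V₂
  span_lie : Submodule.span ℝ {z : g | ∃ x ∈ V₁, ∃ y ∈ V₁, ⁅x, y⁆ = z} = V₂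
  V₂_ne_bot : V₂ ≠ ⊥
  lie_eq_zero : ∀ z ∈ V₂, ∀ x ∈ V₁, ⁅z, x⁆ = 0

namespace StepTwoStratification

section Algebra

variable {g : Type*} [LieRing g] [LieAlgebra ℝ g] (S : StepTwoStratification g)

lemma lie_mem {x y : g} (hx : x ∈ S.V₁) (hy : y ∈ S.V₁) : ⁅x, y⁆ ∈ S.V₂ := by
  rw [← S.span_lie]
  exact Submodule.subset_span ⟨x, hx, y, hy, rfl⟩

lemma exists_decomp (x : g) : ∃ a ∈ S.V₁, ∃ b ∈ S.V₂, a + b = x := by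
  have h : x ∈ S.V₁ ⊔ S.V₂ := by rw [S.isCompl.sup_eq_top]; trivial
  exact Submodule.mem_sup.1 h

lemma lie_V₂ {x z : g} (hz : z ∈ S.V₂) : ⁅x, z⁆ = 0 := by
  have h₁ : ∀ a ∈ S.V₁, ⁅a, z⁆ = 0 := fun a ha => by
    rw [← lie_skew, S.lie_eq_zero z hz a ha, neg_zero]
  have h₂ : ∀ b ∈ S.V₂, ⁅b, z⁆ = 0 := fun b hb => by
    rw [← S.span_lie] at hb
    induction hb using Submodule.span_induction with
    | mem b hb =>
      obtain ⟨p, hp, q, hq, rfl⟩ := hb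
      rw [lie_lie, h₁ q hq, h₁ p hp]; simp
    | zero => simp
    | add b c _ _ hb hc => rw [add_lie, hb, hc, add_zero]
    | smul t b _ hb => rw [smul_lie, hb, smul_zero]
  obtain ⟨a, ha, b, hb, rfl⟩ := S.exists_decomp x
  rw [add_lie, h₁ a ha, h₂ b hb, add_zero]

lemma V₂_lie {x z : g} (hz : z ∈ S.V₂) : ⁅z, x⁆ = 0 := by
  rw [← lie_skew, S.lie_V₂ hz, neg_zero]

lemma lie_mem_V₂ (x y : g) : ⁅x, y⁆ ∈ S.V₂ := by
  obtain ⟨a, ha, b, hb, rfl⟩ := S.exists_decomp x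
  obtain ⟨c, hc, d, hd, rfl⟩ := S.exists_decomp y
  rw [add_lie, lie_add, lie_add, S.lie_V₂ hd, S.lie_V₂ hd, S.V₂_lie hb]
  simpa using S.lie_mem ha hc

lemma lie_lie_zero (S : StepTwoStratification g) (x y z : g) : ⁅x, ⁅y, z⁆⁆ = 0 := S.lie_V₂ (S.lie_mem_V₂ y z)

lemma lie_lie_zero' (S : StepTwoStratification g) (x y z : g) : ⁅⁅x, y⁆, z⁆ = 0 := S.V₂_lie (S.lie_mem_V₂ x y)

end Algebra

noncomputable section

variable {g : Type*} [NormedRealLieAlgebra g] (S : StepTwoStratification g)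

/-- The Carnot group of the stratified Lie algebra `g = V₁ ⊕ V₂`, in exponential coordinates: its
underlying manifold is the vector space `g`, and its product is given by the
Baker-Campbell-Hausdorff formula `x * y = x + y + ½ [x, y]`. -/
@[nolint unusedArguments]
def CarnotGroup (_S : StepTwoStratification g) : Type _ := g

namespace CarnotGroup

instance : NormedRealLieAlgebra S.CarnotGroup := inferInstanceAs (NormedRealLieAlgebra g)

instance [FiniteDimensional ℝ g] : FiniteDimensional ℝ S.CarnotGroup :=
  inferInstanceAs (FiniteDimensional ℝ g)

/-- The exponential map `g → G`, which is the identity in exponential coordinates; see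
`exp_add_smul` and `lie_eq_groupLieAlgebra_bracket` below. -/
def exp : g ≃ₗᵢ[ℝ] S.CarnotGroup := LinearIsometryEquiv.refl ℝ g

/-- The logarithm `G → g`, inverse of the exponential map. -/
def log : S.CarnotGroup ≃ₗᵢ[ℝ] g := LinearIsometryEquiv.refl ℝ g

instance : Mul S.CarnotGroup := ⟨fun x y => x + y + (1 / 2 : ℝ) • ⁅x, y⁆⟩

instance : One S.CarnotGroup := ⟨0⟩

instance : Inv S.CarnotGroup := ⟨fun x => -x⟩

variable {S}

lemma mul_def (x y : S.CarnotGroup) : x * y = x + y + (1 / 2 : ℝ) • ⁅x, y⁆ := rfl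

lemma one_def : (1 : S.CarnotGroup) = 0 := rfl

lemma inv_def (x : S.CarnotGroup) : x⁻¹ = -x := rfl

lemma lie_lie_eq_zero (x y z : S.CarnotGroup) : ⁅x, ⁅y, z⁆⁆ = 0 := S.lie_lie_zero x y z

lemma lie_lie_eq_zero' (x y z : S.CarnotGroup) : ⁅⁅x, y⁆, z⁆ = 0 := S.lie_lie_zero' x y z

instance : Group S.CarnotGroup :=
  Group.ofLeftAxioms
    (fun x y z => by
      simp only [mul_def, add_lie, lie_add, smul_lie, lie_smul, lie_lie_eq_zero, lie_lie_eq_zero',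
        smul_add, smul_zero]
      abel)
    (fun x => by simp [mul_def, one_def])
    (fun x => by simp [mul_def, one_def, inv_def])

/-- One-parameter subgroups are the straight lines through the identity. -/
lemma exp_add_smul (X : g) (s t : ℝ) :
    exp S ((s + t) • X) = exp S (s • X) * exp S (t • X) := by
  rw [mul_def]
  simp [add_smul]

section Smooth

variable [FiniteDimensional ℝ g]

variable (S) in
/-- The Lie bracket as a continuous bilinear map in exponential coordinates. -/
def lieL : S.CarnotGroup →L[ℝ] S.CarnotGroup →L[ℝ] S.CarnotGroup :=
  LinearMap.toContinuousLinearMap (LinearMap.toContinuousLinearMap.toLinearMap.comp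
    (LinearMap.mk₂ ℝ (fun x y : S.CarnotGroup => ⁅x, y⁆) add_lie smul_lie lie_add lie_smul))

@[simp] lemma lieL_apply (x y : S.CarnotGroup) : lieL S x y = ⁅x, y⁆ := rfl

instance : LieGroup 𝓘(ℝ, S.CarnotGroup) ω S.CarnotGroup where
  contMDiff_mul := by
    rw [← modelWithCornersSelf_prod, chartedSpaceSelf_prod]
    exact ContDiff.contMDiff ((contDiff_fst.add contDiff_snd).add
      ((lieL S).isBoundedBilinearMap.contDiff.const_smul _))
  contMDiff_inv := ContDiff.contMDiff contDiff_neg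

instance : SimplyConnectedSpace S.CarnotGroup := inferInstance

lemma hasFDerivAt_mul_left (x y : S.CarnotGroup) :
    HasFDerivAt (fun h => x * h)
      (ContinuousLinearMap.id ℝ S.CarnotGroup + (1 / 2 : ℝ) • lieL S x) y := by
  have h := ((hasFDerivAt_id (𝕜 := ℝ) y).const_add x).add
    ((lieL S x).hasFDerivAt.const_smul (1 / 2 : ℝ) (x := y))
  exact h

/-- The differential at the identity of the left translation by `x`. -/
lemma fderiv_mul_left (x v : S.CarnotGroup) :
    fderiv ℝ (fun h => x * h) 1 v = v + (1 / 2 : ℝ) • ⁅x, v⁆ := by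
  rw [(hasFDerivAt_mul_left x 1).fderiv]; simp

lemma mulInvariantVectorField_eq (v x : S.CarnotGroup) :
    (mulInvariantVectorField (I := 𝓘(ℝ, S.CarnotGroup)) v x : S.CarnotGroup) =
      v + (1 / 2 : ℝ) • ⁅x, v⁆ := by
  rw [← fderiv_mul_left]
  unfold mulInvariantVectorField
  rw [mfderiv_eq_fderiv]
  rfl

/-- The Lie algebra of the Lie group `G` is the Lie algebra `g`. -/
lemma lie_eq_groupLieAlgebra_bracket (v w : g) :
    (exp S ⁅v, w⁆ : S.CarnotGroup) =
      Bracket.bracket (L := GroupLieAlgebra 𝓘(ℝ, S.CarnotGroup) S.CarnotGroup)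
        (M := GroupLieAlgebra 𝓘(ℝ, S.CarnotGroup) S.CarnotGroup) (exp S v) (exp S w) := by
  have hd (z : S.CarnotGroup) : HasFDerivAt
      (fun x : S.CarnotGroup => z + (1 / 2 : ℝ) • ⁅x, z⁆) ((1 / 2 : ℝ) • (lieL S).flip z) 1 :=
    ((((lieL S).flip z).hasFDerivAt).const_smul (1 / 2 : ℝ)).const_add z
  have he (z : S.CarnotGroup) : (mulInvariantVectorField (I := 𝓘(ℝ, S.CarnotGroup)) z :
      S.CarnotGroup → S.CarnotGroup) = fun x => z + (1 / 2 : ℝ) • ⁅x, z⁆ :=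
    funext (mulInvariantVectorField_eq z)
  have key : VectorField.lieBracket ℝ
      (fun x : S.CarnotGroup => exp S v + (1 / 2 : ℝ) • ⁅x, exp S v⁆)
      (fun x : S.CarnotGroup => exp S w + (1 / 2 : ℝ) • ⁅x, exp S w⁆) 1 = ⁅exp S v, exp S w⁆ := by
    rw [VectorField.lieBracket, (hd _).fderiv, (hd _).fderiv]
    simp only [one_def, zero_lie, smul_zero, add_zero, smul_apply,
      ContinuousLinearMap.flip_apply, lieL_apply]
    rw [← lie_skew (exp S v) (exp S w), smul_neg, sub_eq_add_neg, ← neg_add, ← add_smul]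
    norm_num
  rw [← he, ← he] at key
  have hm (V W : (x : S.CarnotGroup) → TangentSpace 𝓘(ℝ, S.CarnotGroup) x) :
      VectorField.mlieBracket 𝓘(ℝ, S.CarnotGroup) V W 1 =
        VectorField.lieBracket (E := S.CarnotGroup) ℝ V W 1 := by
    rw [← VectorField.mlieBracketWithin_univ, VectorField.mlieBracketWithin_eq_lieBracketWithin]
    exact congrFun (VectorField.lieBracketWithin_univ (𝕜 := ℝ) (E := S.CarnotGroup) (V := V) (W := W))
      (1 : S.CarnotGroup)
  exact ((hm _ _).trans key).symm

end Smooth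

end CarnotGroup

/-- Exponential coordinates on `G` with respect to a basis of `g`. -/
def expCoord {n : ℕ} (b : Module.Basis (Fin n) ℝ g) (p : S.CarnotGroup) : Fin n → ℝ :=
  b.equivFun (CarnotGroup.log S p)

/-! ### Horizontal curves and the endpoint map -/

/-- The space of controls `L²([0,1], V₁)`. -/
abbrev Control : Type _ := Lp S.V₁ 2 (volume.restrict (Icc (0 : ℝ) 1))

/-- `γ : [0,1] → G` is the horizontal curve with control `u` leaving from the identity: it is
absolutely continuous, `γ 0 = e`, and `γ' (t) = (d L_{γ t})_e (u t)` for almost every `t ∈ [0,1]`,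
where `L_x` is the left translation by `x`. -/
structure IsHorizontalCurve (u : S.Control) (γ : ℝ → S.CarnotGroup) : Prop where
  absolutelyContinuous : AbsolutelyContinuousOnInterval γ 0 1
  init : γ 0 = 1
  ode : ∀ᵐ t ∂(volume.restrict (Icc (0 : ℝ) 1)),
    HasDerivAt γ (fderiv ℝ (fun h : S.CarnotGroup => γ t * h) 1 (CarnotGroup.exp S (u t))) t

variable {S}

lemma _root_.AbsolutelyContinuousOnInterval.of_dist_le {X Y : Type*} [PseudoMetricSpace X]
    [PseudoMetricSpace Y] {f : ℝ → X} {h : ℝ → Y} {a b C : ℝ}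
    (hh : AbsolutelyContinuousOnInterval h a b)
    (hle : ∀ x ∈ uIcc a b, ∀ y ∈ uIcc a b, dist (f x) (f y) ≤ C * dist (h x) (h y)) :
    AbsolutelyContinuousOnInterval f a b := by
  refine squeeze_zero' (Filter.Eventually.of_forall fun E =>
    Finset.sum_nonneg fun i _ => dist_nonneg) ?_ (by simpa using Filter.Tendsto.const_mul C hh)
  filter_upwards [Filter.mem_inf_of_right (Filter.mem_principal_self _)] with E hE
  rw [Finset.mul_sum]
  exact Finset.sum_le_sum fun i hi => hle _ (hE.1 i hi).1 _ (hE.1 i hi).2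

lemma _root_.IntervalIntegrable.absolutelyContinuousOnInterval_integral {E : Type*}
    [NormedAddCommGroup E] [NormedSpace ℝ E] {f : ℝ → E} {a b : ℝ}
    (h : IntervalIntegrable f volume a b) :
    AbsolutelyContinuousOnInterval (fun x => ∫ t in a..x, f t) a b := by
  refine (h.norm.absolutelyContinuousOnInterval_intervalIntegral left_mem_uIcc).of_dist_le
    (C := 1) fun x hx y hy => ?_
  have hx' := h.mono_set (uIcc_subset_uIcc_left hx)
  have hy' := h.mono_set (uIcc_subset_uIcc_left hy)
  rw [dist_eq_norm, dist_eq_norm, intervalIntegral.integral_interval_sub_left hx' hy',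
    intervalIntegral.integral_interval_sub_left hx'.norm hy'.norm, one_mul, Real.norm_eq_abs]
  exact intervalIntegral.norm_integral_le_abs_integral_norm

variable [FiniteDimensional ℝ g]

/-- Every control is the control of a horizontal curve leaving from the identity. -/
theorem exists_isHorizontalCurve (u : S.Control) : ∃ γ, S.IsHorizontalCurve u γ := by
  set v : ℝ → S.CarnotGroup := fun t => CarnotGroup.exp S (u t) with hv
  have hvi : IntervalIntegrable v volume 0 1 := by
    rw [intervalIntegrable_iff_integrableOn_Icc_of_le zero_le_one]
    have h1 : Integrable u (volume.restrict (Icc (0 : ℝ) 1)) := (Lp.memLp u).integrable one_le_two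
    exact (((CarnotGroup.exp S).toContinuousLinearEquiv.toContinuousLinearMap).comp
      S.V₁.subtypeL).integrable_comp h1
  set U : ℝ → S.CarnotGroup := fun t => ∫ s in (0 : ℝ)..t, v s with hU
  have hUac : AbsolutelyContinuousOnInterval U 0 1 := hvi.absolutelyContinuousOnInterval_integral
  set w : ℝ → S.CarnotGroup := fun t => (1 / 2 : ℝ) • ⁅U t, v t⁆ with hw
  have hwi : IntervalIntegrable w volume 0 1 := by
    rw [intervalIntegrable_iff_integrableOn_Ioc_of_le zero_le_one] at hvi ⊢
    have hUc : ContinuousOn U (Ioc 0 1) :=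
      hUac.continuousOn.mono (by rw [uIcc_of_le zero_le_one]; exact Ioc_subset_Icc_self)
    obtain ⟨C, hC⟩ := hUac.exists_bound
    have hm : AEStronglyMeasurable (fun t => CarnotGroup.lieL S (U t) (v t))
        (volume.restrict (Ioc (0 : ℝ) 1)) :=
      (CarnotGroup.lieL S).aestronglyMeasurable_comp₂
        (hUc.aestronglyMeasurable measurableSet_Ioc) hvi.aestronglyMeasurable
    refine Integrable.smul (1 / 2 : ℝ) ((hvi.norm.const_mul (‖CarnotGroup.lieL S‖ * C)).mono' hm ?_)
    filter_upwards [ae_restrict_mem measurableSet_Ioc] with t ht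
    refine ((CarnotGroup.lieL S).le_opNorm₂ (U t) (v t)).trans ?_
    gcongr
    exact hC t (by rw [uIcc_of_le zero_le_one]; exact Ioc_subset_Icc_self ht)
  refine ⟨fun t => ∫ s in (0 : ℝ)..t, (v s + w s),
    (hvi.add hwi).absolutelyContinuousOnInterval_integral, by simp [CarnotGroup.one_def], ?_⟩
  rw [ae_restrict_iff' measurableSet_Icc]
  filter_upwards [(hvi.add hwi).ae_hasDerivAt_integral] with t ht ht01
  rw [← uIcc_of_le (zero_le_one' ℝ)] at ht01
  refine (ht ht01 0 left_mem_uIcc).congr_deriv ?_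
  have hsub := uIcc_subset_uIcc_left ht01
  rw [CarnotGroup.fderiv_mul_left, intervalIntegral.integral_add (hvi.mono_set hsub)
    (hwi.mono_set hsub), add_lie]
  have h0 : ⁅∫ s in (0 : ℝ)..t, w s, v t⁆ = 0 := by
    rw [← CarnotGroup.lieL_apply, ← ContinuousLinearMap.flip_apply,
      ← ContinuousLinearMap.intervalIntegral_comp_comm _ (hwi.mono_set hsub)]
    simp [hw, CarnotGroup.lie_lie_eq_zero', -lie_lie]
  change v t + w t = v t + (1 / 2 : ℝ) • (⁅U t, v t⁆ + ⁅∫ s in (0 : ℝ)..t, w s, v t⁆)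
  rw [h0, add_zero]

/-- The horizontal curve leaving from the identity is determined on `[0,1]` by its control. -/
theorem IsHorizontalCurve.eqOn {u : S.Control} {γ₁ γ₂ : ℝ → S.CarnotGroup}
    (h₁ : S.IsHorizontalCurve u γ₁) (h₂ : S.IsHorizontalCurve u γ₂) :
    EqOn γ₁ γ₂ (Icc 0 1) := by
  have hac : AbsolutelyContinuousOnInterval (fun t => γ₁ t - γ₂ t) 0 1 :=
    h₁.absolutelyContinuous.fun_sub h₂.absolutelyContinuous
  have hder : ∀ᵐ t, t ∈ uIcc (0 : ℝ) 1 → HasDerivAt (fun t => γ₁ t - γ₂ t)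
      ((1 / 2 : ℝ) • ⁅γ₁ t - γ₂ t, CarnotGroup.exp S (u t)⁆) t := by
    rw [uIcc_of_le zero_le_one, ← ae_restrict_iff' measurableSet_Icc]
    filter_upwards [h₁.ode, h₂.ode] with t ht₁ ht₂
    refine (ht₁.sub ht₂).congr_deriv ?_
    rw [CarnotGroup.fderiv_mul_left, CarnotGroup.fderiv_mul_left, sub_lie, smul_sub]
    abel
  have hzero : γ₁ 0 - γ₂ 0 = 0 := by rw [h₁.init, h₂.init, sub_self]
  have hlie (x : S.CarnotGroup) : ∀ t ∈ uIcc (0 : ℝ) 1, ⁅γ₁ t - γ₂ t, x⁆ = 0 := by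
    have hac' : AbsolutelyContinuousOnInterval (fun t => ⁅γ₁ t - γ₂ t, x⁆) 0 1 := by
      refine hac.of_dist_le (C := ‖(CarnotGroup.lieL S).flip x‖) fun s _ t _ => ?_
      rw [dist_eq_norm, dist_eq_norm, ← sub_lie]
      exact ((CarnotGroup.lieL S).flip x).le_opNorm _
    obtain ⟨C, hC⟩ := hac'.const_of_ae_hasDerivAt_zero (by
      filter_upwards [hder] with t ht ht01
      refine (((CarnotGroup.lieL S).flip x).hasFDerivAt.comp_hasDerivAt t (ht ht01)).congr_deriv ?_
      rw [ContinuousLinearMap.flip_apply, CarnotGroup.lieL_apply, smul_lie,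
        CarnotGroup.lie_lie_eq_zero', smul_zero])
    intro t ht
    rw [hC t ht, ← hC 0 left_mem_uIcc, hzero, zero_lie]
  obtain ⟨C, hC⟩ := hac.const_of_ae_hasDerivAt_zero (by
    filter_upwards [hder] with t ht ht01
    have := ht ht01
    rwa [hlie _ t ht01, smul_zero] at this)
  intro t ht
  rw [← uIcc_of_le (zero_le_one' ℝ)] at ht
  have := hC t ht
  rw [← hC 0 left_mem_uIcc, hzero] at this
  exact sub_eq_zero.1 this

variable (S)

/-- The endpoint map `End : L²([0,1], V₁) → G`, `u ↦ γ_u(1)`. -/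
def endpoint (u : S.Control) : S.CarnotGroup := (exists_isHorizontalCurve u).choose 1

variable {S} in
lemma IsHorizontalCurve.endpoint_eq {u : S.Control} {γ : ℝ → S.CarnotGroup}
    (h : S.IsHorizontalCurve u γ) : S.endpoint u = γ 1 :=
  (exists_isHorizontalCurve u).choose_spec.eqOn h (right_mem_Icc.2 zero_le_one)

/-- A curve `γ` leaving from the identity is abnormal if it is horizontal and the differential of
the endpoint map at its control is not onto the tangent space at `γ 1`. -/
def IsAbnormal (γ : ℝ → S.CarnotGroup) : Prop :=
  ∃ u : S.Control, S.IsHorizontalCurve u γ ∧ ¬ Function.Surjective (fderiv ℝ S.endpoint u)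

/-- The abnormal set of `G`: the set of the endpoints of the abnormal curves. -/
def abnormalSet : Set S.CarnotGroup := {p | ∃ γ, S.IsAbnormal γ ∧ γ 1 = p}

end

end StepTwoStratification

/-! ### Real algebraic sets -/

/-- A (real, affine) algebraic subset of `ℝⁿ`: the set of common zeros of an ideal of
polynomials. -/
def IsRealAlgebraicSet {n : ℕ} (Z : Set (Fin n → ℝ)) : Prop :=
  ∃ I : Ideal (MvPolynomial (Fin n) ℝ), Z = MvPolynomial.zeroLocus ℝ I

/-- The dimension of an algebraic subset of `ℝⁿ`: the Krull dimension of its ring of polynomial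
functions `ℝ[x₁, …, xₙ] / I(Z)`, where `I(Z)` is the ideal of all polynomials vanishing on `Z`. -/
noncomputable def realAlgebraicDim {n : ℕ} (Z : Set (Fin n → ℝ)) : WithBot ℕ∞ :=
  ringKrullDim (MvPolynomial (Fin n) ℝ ⧸ MvPolynomial.vanishingIdeal ℝ Z)

/-! Let r and s be the dimensions of the two layers. In step 2 the endpoint map is a quadratic
polynomial of the control. If a nonzero covector kills the image of its differential at u, testing
against suitable controls shows that the primitive of u stays in the radical W of the form f[·,·] on
V₁, where f is the covector and is nonzero on V₂. The control then takes values in W almost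
everywhere, so the endpoint lies in W + [W, W] (`exists_radical_of_isAbnormal`). It remains to bound
the dimension of the union of these sets over all f.

The restriction of f to V₂, up to scaling, has s − 1 parameters. A nonzero alternating form has rank
at least 2, so dim W ≤ r − 2. Also [W, W] ⊆ ker f gives dim [W, W] ≤ s − 1, and dim [W, W] ≤ 1 when
dim W ≤ 2. With r + s ≤ 7, three cases give at most r + s − 3. If the rank is at least 4, W loses
two more dimensions. If the rank is 2 and f satisfies an algebraic relation, the parameters lose
one. If the rank is 2 for generic f, all Pfaffians vanish identically, hence every form has rank at
most 2, and comparing f ± m forces [W, W] = 0. This is `exists_finset_card_add_three_le`.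

Dimension is counted as transcendence degree. `ringKrullDim_quotient_vanishingIdeal_le` reduces the
bound on the Zariski closure of a set A to points over fields K that receive a homomorphism from the
ring of all functions A → ℝ. Since all functions are allowed, the form and the vectors of its
radical may be chosen arbitrarily at each point of A, without any regularity, and their relations
pass to K. -/

/-! ### Algebraic hulls -/

section AlgHull

variable {k K : Type*} [Field k] [Field K] [Algebra k K]

/-- The relative algebraic closure in `K` of the subfield generated by `T` over `k`. -/
def algHull (k : Type*) {K : Type*} [Field k] [Field K] [Algebra k K] (T : Set K) :
    IntermediateField k K where
  __ := (Subalgebra.algebraicClosure (Algebra.adjoin k T) K).restrictScalars k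
  inv_mem' _ hx := IsAlgebraic.inv hx

lemma mem_algHull_iff {T : Set K} {a : K} :
    a ∈ algHull k T ↔ IsAlgebraic (Algebra.adjoin k T) a := Iff.rfl

lemma mem_algHull_iff_mem_closure {T : Set K} {a : K} :
    a ∈ algHull k T ↔ a ∈ (AlgebraicIndependent.matroid k K).closure T := by
  rw [AlgebraicIndependent.matroid_closure_eq]; rfl

lemma subset_algHull (T : Set K) : T ⊆ algHull k T := fun a ha => by
  exact mem_algHull_iff_mem_closure.2
    ((AlgebraicIndependent.matroid k K).subset_closure T (Set.subset_univ _) ha)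

lemma algHull_mono {T U : Set K} (h : T ⊆ U) : algHull k T ≤ algHull k U := fun a ha => by
  have := (AlgebraicIndependent.matroid k K).closure_subset_closure h
    (mem_algHull_iff_mem_closure.1 ha)
  exact mem_algHull_iff_mem_closure.2 this

/-- Algebraically independent elements of the hull of `T` are at most as many as those of `T`. -/
lemma AlgebraicIndependent.le_card_of_mem_algHull {m : ℕ} {y : Fin m → K}
    (hy : AlgebraicIndependent k y) {T : Finset K} (h : ∀ i, y i ∈ algHull k (T : Set K)) :
    m ≤ T.card := by
  have hind : (AlgebraicIndependent.matroid k K).Indep (range y) :=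
    AlgebraicIndependent.matroid_indep_iff.2 ((algebraicIndependent_subtype_range hy.injective).2 hy)
  have hsub : range y ⊆ (AlgebraicIndependent.matroid k K).closure T := by
    rintro _ ⟨i, rfl⟩
    exact mem_algHull_iff_mem_closure.1 (h i)
  have h1 := hind.encard_le_eRk_of_subset hsub
  rw [Matroid.eRk_closure_eq] at h1
  have h2 := h1.trans ((AlgebraicIndependent.matroid k K).eRk_le_encard T)
  rw [Set.encard_coe_eq_coe_finsetCard] at h2
  have h3 := hy.injective.encard_range.trans h2
  simpa using h3

/-- Of finitely many algebraically dependent elements, one is algebraic over the others. -/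
lemma exists_mem_algHull_of_not_algebraicIndepOn {ι : Type*} {y : ι → K} {J : Finset ι}
    (h : ¬ AlgebraicIndepOn k y (J : Set ι)) :
    ∃ j ∈ J, y j ∈ algHull k (y '' (J \ {j} : Set ι)) := by
  classical
  induction J using Finset.induction_on with
  | empty =>
    refine absurd ?_ h
    rw [Finset.coe_empty]
    exact (algebraicIndependent_empty_type_iff (R := k) (A := K)).2
      (FaithfulSMul.algebraMap_injective k K)
  | insert i J hi ih =>
    by_cases hJ : AlgebraicIndepOn k y (J : Set ι)
    · refine ⟨i, Finset.mem_insert_self i J, ?_⟩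
      have h1 : ((insert i J : Finset ι) \ {i} : Set ι) = J := by
        rw [Finset.coe_insert, Set.insert_sdiff_of_mem _ (Set.mem_singleton i)]
        exact Set.sdiff_singleton_eq_self (by simpa using hi)
      rw [h1]
      by_contra hmem
      exact h (by rw [Finset.coe_insert]; exact hJ.insert hmem)
    · obtain ⟨j, hj, hmem⟩ := ih hJ
      refine ⟨j, Finset.mem_insert_of_mem hj, algHull_mono (Set.image_mono ?_) hmem⟩
      exact Set.sdiff_subset_sdiff_left (by simp)

end AlgHull

/-! ### Krull dimension -/

/-- An integral extension of a ring has at most the Krull dimension of the ring. -/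
lemma ringKrullDim_le_of_isIntegral {A B : Type*} [CommRing A] [CommRing B] {f : A →+* B}
    (hf : f.IsIntegral) : ringKrullDim B ≤ ringKrullDim A := by
  algebraize [f]
  have : Algebra.IsIntegral A B := ⟨hf⟩
  -- Incomparability: along an integral extension, contraction of primes preserves strict
  -- inclusions.
  refine Order.krullDim_le_of_strictMono (PrimeSpectrum.comap f) fun I J h => ?_
  exact Ideal.IsIntegral.comap_lt_comap (R := A) (I := I.asIdeal) (J := J.asIdeal) h

/-- If a subset `A` of `ℝⁿ` is such that the transcendence degree of the coordinates of every generic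
point of `A` is at most `d`, then the Zariski closure of `A` has dimension at most `d`. Here generic
points are those with coordinates in a field to which the ring of all real functions on `A` maps. -/
theorem ringKrullDim_quotient_vanishingIdeal_le {n d : ℕ} (A : Set (Fin n → ℝ))
    (h : ∀ (K : Type) [Field K] [Algebra ℝ K] (φ : (A → ℝ) →ₐ[ℝ] K),
      ∃ T : Finset K, T.card ≤ d ∧ ∀ i, φ (fun a => a.1 i) ∈ algHull ℝ (T : Set K)) :
    ringKrullDim (MvPolynomial (Fin n) ℝ ⧸ MvPolynomial.vanishingIdeal ℝ A) ≤ d := by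
  -- Noether normalization needs a proper ideal; the case of the zero quotient is trivial.
  by_cases hA : MvPolynomial.vanishingIdeal (k := ℝ) A = ⊤
  · have : Subsingleton (MvPolynomial (Fin n) ℝ ⧸ MvPolynomial.vanishingIdeal ℝ A) :=
      Ideal.Quotient.subsingleton_iff.2 hA
    rw [ringKrullDim_eq_bot_of_subsingleton]; exact bot_le
  -- Noether normalization: the coordinate ring is integral over a polynomial ring in m variables,
  -- so m ≤ d is enough.
  obtain ⟨m, -, g, hg, hint⟩ := exists_integral_inj_algHom_of_quotient _ hA
  refine (ringKrullDim_le_of_isIntegral hint).trans ?_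
  rw [MvPolynomial.ringKrullDim_of_isNoetherianRing, ringKrullDim_eq_zero_of_field, zero_add]
  simp only [Nat.card_eq_fintype_card, Fintype.card_fin]
  let ev : MvPolynomial (Fin n) ℝ →ₐ[ℝ] (A → ℝ) := MvPolynomial.aeval fun i a => a.1 i
  have hev (p : MvPolynomial (Fin n) ℝ) (a : A) : ev p a = MvPolynomial.aeval a.1 p := by
    have : (Pi.evalAlgHom ℝ (fun _ : A => ℝ) a).comp ev = MvPolynomial.aeval a.1 := by
      ext i; simp [ev]
    exact DFunLike.congr_fun this p
  have hker (p : MvPolynomial (Fin n) ℝ) : ev p = 0 ↔ p ∈ MvPolynomial.vanishingIdeal ℝ A := by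
    rw [MvPolynomial.mem_vanishingIdeal_iff, funext_iff]
    simp [hev]
  let q : (MvPolynomial (Fin n) ℝ ⧸ MvPolynomial.vanishingIdeal ℝ A) →ₐ[ℝ] (A → ℝ) :=
    Ideal.Quotient.liftₐ _ ev fun p hp => (hker p).2 hp
  have hq : Function.Injective q := by
    rw [injective_iff_map_eq_zero]
    intro p
    obtain ⟨p, rfl⟩ := Ideal.Quotient.mk_surjective p
    intro hp
    exact Ideal.Quotient.eq_zero_iff_mem.2 ((hker p).1 hp)
  -- The nonzero polynomials in the m normalizing elements form a multiplicative set avoiding 0 in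
  -- the ring of functions. A prime P that misses it keeps these elements algebraically independent
  -- in the fraction field of the quotient by P.
  let M : Submonoid (A → ℝ) := (nonZeroDivisors (MvPolynomial (Fin m) ℝ)).map (q.comp g)
  have hdisj : Disjoint ((⊥ : Ideal (A → ℝ)) : Set (A → ℝ)) M := by
    rw [Set.disjoint_left]
    rintro _ rfl ⟨p, hp, hp0⟩
    have : p = 0 := hg (hq (by simpa using hp0))
    exact nonZeroDivisors.ne_zero hp this
  obtain ⟨P, hP, -, hPM⟩ := Ideal.exists_le_prime_disjoint _ _ hdisj
  let K := FractionRing ((A → ℝ) ⧸ P)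
  let φ : (A → ℝ) →ₐ[ℝ] K :=
    (IsScalarTower.toAlgHom ℝ ((A → ℝ) ⧸ P) K).comp (Ideal.Quotient.mkₐ ℝ P)
  have hφ (f : A → ℝ) : φ f = 0 → f ∈ P := fun hf => by
    rw [← Ideal.Quotient.eq_zero_iff_mem]
    exact (IsFractionRing.injective ((A → ℝ) ⧸ P) K) (by simpa [φ] using hf)
  obtain ⟨T, hT, hmem⟩ := h K φ
  have hall (p : MvPolynomial (Fin n) ℝ) : φ (ev p) ∈ algHull ℝ (T : Set K) := by
    have : (φ.comp ev) = (algHull ℝ (T : Set K)).val.comp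
        (MvPolynomial.aeval fun i => (⟨_, hmem i⟩ : algHull ℝ (T : Set K))) := by
      ext i; simp [ev]
    have := DFunLike.congr_fun this p
    rw [AlgHom.comp_apply] at this
    rw [this]
    exact Subtype.coe_prop _
  have hind : AlgebraicIndependent ℝ (fun i : Fin m => φ (q (g (MvPolynomial.X i)))) := by
    rw [algebraicIndependent_iff]
    intro p hp
    have h1 : (MvPolynomial.aeval fun i : Fin m => φ (q (g (MvPolynomial.X i)))) =
        (φ.comp q).comp g := by ext i; simp
    rw [h1] at hp
    by_contra hne
    exact Set.disjoint_left.1 hPM (hφ _ hp) ⟨p, mem_nonZeroDivisors_of_ne_zero hne, rfl⟩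
  have := hind.le_card_of_mem_algHull (T := T) fun i => by
    obtain ⟨p, hp⟩ := Ideal.Quotient.mk_surjective (g (MvPolynomial.X i))
    rw [← hp]
    exact hall p
  exact_mod_cast this.trans hT

/-! ### Alternating forms -/

section Alternating

variable {L V U : Type*} [Field L] [AddCommGroup V] [Module L V]
  [AddCommGroup U] [Module L U]

/-- An invertible Gram matrix makes x ↦ (B(x, vⱼ))ⱼ surjective onto `Fin m → L`, and the kernel of
this map contains the radical of B. -/
lemma finrank_ker_add_le_of_det_ne_zero [FiniteDimensional L V] {m : ℕ} (B : V →ₗ[L] V →ₗ[L] L) (v : Fin m → V)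
    (h : (Matrix.of fun i j => B (v i) (v j)).det ≠ 0) :
    Module.finrank L (LinearMap.ker B) + m ≤ Module.finrank L V := by
  let Φ : V →ₗ[L] (Fin m → L) := LinearMap.pi fun j => B.flip (v j)
  have hsurj : Function.Surjective Φ := by
    intro y
    have hu : IsUnit (Matrix.of fun i j => B (v i) (v j)).det := isUnit_iff_ne_zero.2 h
    let c := Matrix.vecMul y (Matrix.of fun i j => B (v i) (v j))⁻¹
    refine ⟨∑ i, c i • v i, ?_⟩
    have hc : Matrix.vecMul c (Matrix.of fun i j => B (v i) (v j)) = y := by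
      rw [Matrix.vecMul_vecMul, Matrix.nonsing_inv_mul _ hu, Matrix.vecMul_one]
    rw [← hc]
    ext j
    simp [Φ, Matrix.vecMul, dotProduct]
  have h1 := LinearMap.finrank_range_add_finrank_ker Φ
  rw [LinearMap.range_eq_top.2 hsurj, finrank_top, Module.finrank_fin_fun] at h1
  have h2 : LinearMap.ker B ≤ LinearMap.ker Φ := fun x hx => by
    rw [LinearMap.mem_ker] at hx ⊢
    ext j
    simp [Φ, hx]
  have := Submodule.finrank_mono h2
  omega

/-- The Pfaffian of the Gram matrix of four vectors. -/
def pfaffian (B : V →ₗ[L] V →ₗ[L] L) (a b x y : V) : L :=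
  B a b * B x y - B a x * B b y + B a y * B b x

lemma finrank_ker_add_two_le [FiniteDimensional L V] {B : V →ₗ[L] V →ₗ[L] L}
    (hB : B.IsAlt) {a b : V} (h : B a b ≠ 0) :
    Module.finrank L (LinearMap.ker B) + 2 ≤ Module.finrank L V := by
  refine finrank_ker_add_le_of_det_ne_zero B ![a, b] ?_
  have : B b a = - B a b := by rw [hB.neg]
  simpa [Matrix.det_fin_two, hB a, hB b, this] using h

lemma finrank_ker_add_four_le [FiniteDimensional L V] {B : V →ₗ[L] V →ₗ[L] L}
    (hB : B.IsAlt) {a b x y : V}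
    (h : pfaffian B a b x y ≠ 0) :
    Module.finrank L (LinearMap.ker B) + 4 ≤ Module.finrank L V := by
  refine finrank_ker_add_le_of_det_ne_zero B ![a, b, x, y] ?_
  have hs (u v : V) : B u v = - B v u := by rw [hB.neg]
  -- The determinant of an alternating 4 × 4 matrix is the square of its Pfaffian.
  have : (Matrix.of fun i j => B (![a, b, x, y] i) (![a, b, x, y] j)).det =
      pfaffian B a b x y ^ 2 := by
    simp [Matrix.det_succ_row_zero, Fin.sum_univ_succ, Fin.succAbove, pfaffian, hB a, hB b, hB x,
      hB y]
    rw [hs b a, hs x a, hs x b, hs y a, hs y b, hs y x]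
    ring
  rw [this]
  exact pow_ne_zero 2 h

/-- The span of the values of a bilinear map on the vectors of a subspace. -/
def spanValues (β : V →ₗ[L] V →ₗ[L] U) (W : Submodule L V) : Submodule L U :=
  Submodule.span L {z | ∃ a ∈ W, ∃ b ∈ W, β a b = z}

/-- If u and v span a space containing W, every value of β on W is a multiple of β u v. -/
lemma finrank_spanValues_le_one [FiniteDimensional L V] {β : V →ₗ[L] V →ₗ[L] U} (hβ : β.IsAlt) {W : Submodule L V}
    (hW : Module.finrank L W ≤ 2) : Module.finrank L (spanValues β W) ≤ 1 := by
  obtain ⟨u, v, huv⟩ : ∃ u v : V, W ≤ Submodule.span L {u, v} := by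
    let b := Module.finBasis L W
    -- The basis is padded with zeros, so that dimensions 0, 1 and 2 are treated together.
    let f : ℕ → V := fun i => if h : i < Module.finrank L W then b ⟨i, h⟩ else 0
    refine ⟨f 0, f 1, ?_⟩
    have h1 : Submodule.span L (range fun i => (b i : V)) = W := by
      have := congrArg (Submodule.map W.subtype) b.span_eq
      rwa [Submodule.map_span, ← range_comp, Submodule.map_top, Submodule.range_subtype] at this
    rw [← h1, Submodule.span_le]
    rintro _ ⟨⟨i, hi⟩, rfl⟩
    have h2 : (b ⟨i, hi⟩ : V) = f i := by simp [f, hi]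
    simp only [h2]
    refine Submodule.subset_span ?_
    have : i < 2 := by omega
    interval_cases i <;> simp
  have hle : spanValues β W ≤ Submodule.span L {β u v} := by
    refine Submodule.span_le.2 ?_
    rintro _ ⟨a, ha, b, hb, rfl⟩
    obtain ⟨p, q, rfl⟩ := Submodule.mem_span_pair.1 (huv ha)
    obtain ⟨p', q', rfl⟩ := Submodule.mem_span_pair.1 (huv hb)
    refine Submodule.mem_span_singleton.2 ⟨p * q' - q * p', ?_⟩
    have : β v u = - β u v := by rw [hβ.neg]
    simp only [map_add, map_smul, LinearMap.add_apply, LinearMap.smul_apply, hβ u, hβ v, this]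
    module
  exact (Submodule.finrank_mono hle).trans ((finrank_span_le_card ({β u v} : Set U)).trans (by simp))

/-- The values of β on the radical of l ∘ β lie in ker l, which is a proper subspace. -/
lemma finrank_spanValues_ker_lt [FiniteDimensional L U] (β : V →ₗ[L] V →ₗ[L] U) {l : U →ₗ[L] L} (hl : l ≠ 0) :
    Module.finrank L (spanValues β (LinearMap.ker (β.compr₂ l))) < Module.finrank L U := by
  refine Submodule.finrank_lt (lt_of_le_of_lt ?_ (lt_top_iff_ne_top.2
    fun h => hl (LinearMap.ker_eq_top.1 h)) : _ < (⊤ : Submodule L U)).ne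
  refine Submodule.span_le.2 ?_
  rintro _ ⟨a, ha, b, -, rfl⟩
  have := LinearMap.congr_fun (LinearMap.mem_ker.1 ha) b
  simpa using this

/-- If the forms `l ± m` of a bilinear map have rank two, then `m` kills the bracket of the
elements of the radical of `l`. -/
lemma apply_apply_eq_zero_of_pfaffian [CharZero L] {β : V →ₗ[L] V →ₗ[L] U} {l m : U →ₗ[L] L}
    {a b w w' : V} (hab : l (β a b) ≠ 0)
    (hadd : pfaffian (β.compr₂ (l + m)) a b w w' = 0)
    (hsub : pfaffian (β.compr₂ (l - m)) a b w w' = 0)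
    (hw : ∀ y, l (β y w) = 0) (hw' : ∀ y, l (β y w') = 0) : m (β w w') = 0 := by
  simp only [pfaffian, LinearMap.compr₂_apply, LinearMap.add_apply, LinearMap.sub_apply, hw,
    hw'] at hadd hsub
  -- The terms quadratic in m are the same in both Pfaffians, except for m(β a b) m(β w w'), which
  -- also occurs in both; the difference keeps only the term linear in m.
  have : (2 * l (β a b)) * m (β w w') = 0 := by linear_combination hadd - hsub
  exact (mul_eq_zero.1 this).resolve_left (by simpa using hab)

/-- The Pfaffian is linear in each of its four arguments, so the slots can be reduced to basis
vectors one at a time. -/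
lemma pfaffian_eq_zero_of_basis {ι : Type*} (e : Module.Basis ι L V) {B : V →ₗ[L] V →ₗ[L] L}
    (h : ∀ i j p q, pfaffian B (e i) (e j) (e p) (e q) = 0) (a b x y : V) :
    pfaffian B a b x y = 0 := by
  have ext (f : V → L) (h1 : ∀ u v, f (u + v) = f u + f v) (h2 : ∀ (t : L) v, f (t • v) = t * f v)
      (h3 : ∀ i, f (e i) = 0) (v : V) : f v = 0 := by
    have : IsLinearMap.mk' f ⟨h1, h2⟩ = 0 := e.ext fun i => h3 i
    exact LinearMap.congr_fun this v
  refine ext (fun a => pfaffian B a b x y) ?_ ?_ (fun i => ?_) a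
  · intro u v; simp only [pfaffian, map_add, LinearMap.add_apply]; ring
  · intro u v; simp only [pfaffian, map_smul, LinearMap.smul_apply, smul_eq_mul]; ring
  refine ext (fun b => pfaffian B (e i) b x y) ?_ ?_ (fun j => ?_) b
  · intro u v; simp only [pfaffian, map_add, LinearMap.add_apply]; ring
  · intro u v; simp only [pfaffian, map_smul, LinearMap.smul_apply, smul_eq_mul]; ring
  refine ext (fun x => pfaffian B (e i) (e j) x y) ?_ ?_ (fun p => ?_) x
  · intro u v; simp only [pfaffian, map_add, LinearMap.add_apply]; ring
  · intro u v; simp only [pfaffian, map_smul, LinearMap.smul_apply, smul_eq_mul]; ring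
  refine ext (fun y => pfaffian B (e i) (e j) (e p) y) ?_ ?_ (fun q => h i j p q) y
  · intro u v; simp only [pfaffian, map_add]; ring
  · intro u v; simp only [pfaffian, map_smul, smul_eq_mul]; ring

end Alternating

/-! ### Bilinear maps with real structure constants -/

section StructureConstants

variable {r s : ℕ} (c : Fin r → Fin r → Fin s → ℝ)

/-- The bilinear map with real structure constants `c` over an extension `F` of `ℝ`. -/
def structureMap (F : Type*) [Field F] [Algebra ℝ F] :
    (Fin r → F) →ₗ[F] (Fin r → F) →ₗ[F] (Fin s → F) :=
  LinearMap.mk₂ F (fun x y k => ∑ i, ∑ j, x i * y j * algebraMap ℝ F (c i j k))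
    (fun x x' y => by ext k; simp [add_mul, Finset.sum_add_distrib])
    (fun t x y => by ext k; simp [Finset.mul_sum, mul_assoc])
    (fun x y y' => by ext k; simp [mul_add, add_mul, Finset.sum_add_distrib])
    (fun t x y => by
      ext k; simp only [Pi.smul_apply, smul_eq_mul, Finset.mul_sum]
      exact Finset.sum_congr rfl fun i _ => Finset.sum_congr rfl fun j _ => by ring)

lemma structureMap_apply {F : Type*} [Field F] [Algebra ℝ F] (x y : Fin r → F) (k : Fin s) :
    structureMap c F x y k = ∑ i, ∑ j, x i * y j * algebraMap ℝ F (c i j k) := rfl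

lemma structureMap_single {F : Type*} [Field F] [Algebra ℝ F] (i j : Fin r) (k : Fin s) :
    structureMap c F (Pi.single i 1) (Pi.single j 1) k = algebraMap ℝ F (c i j k) := by
  rw [structureMap_apply, Finset.sum_eq_single i, Finset.sum_eq_single j] <;>
    simp +contextual [Pi.single_apply]

variable {c} in
lemma structureMap_isAlt (hc : ∀ i j k, c i j k = - c j i k) (F : Type*) [Field F] [Algebra ℝ F]
    [CharZero F] : (structureMap c F).IsAlt := by
  intro x
  ext k
  have h : structureMap c F x x k = - structureMap c F x x k := by
    conv_lhs => rw [structureMap_apply, Finset.sum_comm]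
    rw [structureMap_apply, ← Finset.sum_neg_distrib]
    refine Finset.sum_congr rfl fun i _ => ?_
    rw [← Finset.sum_neg_distrib]
    refine Finset.sum_congr rfl fun j _ => ?_
    rw [hc j i k, map_neg]; ring
  simpa using (self_eq_neg.1 h)

/-- The linear functional with the coefficients `l`. -/
def dotFunctional {F : Type*} [Field F] (l : Fin s → F) : (Fin s → F) →ₗ[F] F :=
  ∑ k, l k • LinearMap.proj k

lemma dotFunctional_apply {F : Type*} [Field F] (l z : Fin s → F) :
    dotFunctional l z = ∑ k, l k * z k := by
  simp [dotFunctional]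

/-- The bilinear form obtained by composing the bilinear map with a functional. -/
def structureForm {F : Type*} [Field F] [Algebra ℝ F] (l : Fin s → F) :
    (Fin r → F) →ₗ[F] (Fin r → F) →ₗ[F] F :=
  (structureMap c F).compr₂ (dotFunctional l)

lemma structureForm_apply {F : Type*} [Field F] [Algebra ℝ F] (l : Fin s → F) (x y : Fin r → F) :
    structureForm c l x y = ∑ k, l k * structureMap c F x y k := by
  simp [structureForm, dotFunctional_apply]

lemma structureForm_single {F : Type*} [Field F] [Algebra ℝ F] (l : Fin s → F) (i j : Fin r) :
    structureForm c l (Pi.single i 1) (Pi.single j 1) = ∑ k, l k * algebraMap ℝ F (c i j k) := by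
  simp [structureForm_apply, structureMap_single]

variable {c} in
lemma structureForm_isAlt (hc : ∀ i j k, c i j k = - c j i k) {F : Type*} [Field F] [Algebra ℝ F]
    [CharZero F] (l : Fin s → F) : (structureForm c l).IsAlt := fun x => by
  simp [structureForm, structureMap_isAlt hc F x]

/-- If the rank of the form with generic coefficients is two, then so is it for all coefficients. -/
lemma pfaffian_structureForm_eq_zero_of_generic.{u} {K F : Type u} [Field K] [Algebra ℝ K]
    [Field F] [Algebra ℝ F] {i₀ : Fin s} {l : Fin s → K} (hl : l i₀ = 1)
    (hind : AlgebraicIndepOn ℝ l ((Finset.univ.erase i₀ : Finset (Fin s)) : Set (Fin s)))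
    (h : ∀ i j p q, pfaffian (structureForm c l) (Pi.single i 1) (Pi.single j 1) (Pi.single p 1)
      (Pi.single q 1) = 0)
    {m : Fin s → F} (hm : m i₀ = 1) (a b x y : Fin r → F) :
    pfaffian (structureForm c m) a b x y = 0 := by
  refine pfaffian_eq_zero_of_basis (Pi.basisFun F (Fin r)) (fun i j p q => ?_) a b x y
  simp only [Pi.basisFun_apply]
  let J := ((Finset.univ.erase i₀ : Finset (Fin s)) : Set (Fin s))
  -- Dehomogenized coordinates: the variable of index i₀ is replaced by 1.
  let X : Fin s → MvPolynomial J ℝ := fun k =>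
    if hk : k ∈ J then MvPolynomial.X ⟨k, hk⟩ else 1
  let w : Fin r → Fin r → MvPolynomial J ℝ := fun i j => ∑ k, X k * MvPolynomial.C (c i j k)
  let P := w i j * w p q - w i p * w j q + w i q * w j p
  have hX {E : Type u} [Field E] [Algebra ℝ E] {n : Fin s → E} (hn : n i₀ = 1) (k : Fin s) :
      MvPolynomial.aeval (fun k : J => n k) (X k) = n k := by
    by_cases hk : k ∈ J
    · simp [X, hk]
    · have : k = i₀ := by simpa [J] using hk
      subst this
      simp [X, hk, hn]
  have hP {E : Type u} [Field E] [Algebra ℝ E] {n : Fin s → E} (hn : n i₀ = 1) :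
      MvPolynomial.aeval (fun k : J => n k) P = pfaffian (structureForm c n) (Pi.single i 1)
        (Pi.single j 1) (Pi.single p 1) (Pi.single q 1) := by
    simp [P, w, pfaffian, structureForm_single, hX hn]
  -- P has real coefficients and vanishes at an algebraically independent point, so it is the zero
  -- polynomial.
  have hP0 : P = 0 := hind (by rw [map_zero]; exact (hP hl).trans (h i j p q))
  rw [← hP hm, hP0, map_zero]

end StructureConstants

/-! ### Base change -/

section BaseChange

variable {K : Type*} [Field K] [Algebra ℝ K] (L : IntermediateField ℝ K)

/-- The inclusion of `Lⁿ` in `Kⁿ`. -/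
noncomputable def inclPi (n : ℕ) : (Fin n → L) →ₗ[L] (Fin n → K) :=
  LinearMap.pi fun i => (Algebra.linearMap L K) ∘ₗ LinearMap.proj i

@[simp] lemma inclPi_apply {n : ℕ} (x : Fin n → L) (i : Fin n) : inclPi L n x i = (x i : K) := rfl

/-- The solutions over `K` of a homogeneous linear system over `L` are combinations of solutions
over `L`. -/
lemma mem_span_image_of_sum_eq_zero {n : ℕ} {ι : Type*} (M : Fin n → ι → L) (W : Set (Fin n → L))
    (hW : ∀ y : Fin n → L, (∀ j, ∑ i, y i * M i j = 0) → y ∈ W) {x : Fin n → K}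
    (hx : ∀ j, ∑ i, x i * (M i j : K) = 0) : x ∈ Submodule.span K (inclPi L n '' W) := by
  classical
  -- The coordinates of x are expanded in a basis of K over L. The system has coefficients in L, so
  -- each vector of expansion coefficients solves it separately.
  let e := Module.Basis.ofVectorSpace L K
  let S := Finset.univ.biUnion fun i => (e.repr (x i)).support
  have hsum : x = ∑ t ∈ S, e t • inclPi L n (fun i => e.repr (x i) t) := by
    ext i
    rw [Finset.sum_apply]
    conv_lhs => rw [← e.linearCombination_repr (x i), Finsupp.linearCombination_apply,
      Finsupp.sum_of_support_subset (s := S) _ (Finset.subset_biUnion_of_mem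
        (fun i => (e.repr (x i)).support) (Finset.mem_univ i)) _ (by simp)]
    refine Finset.sum_congr rfl fun t _ => ?_
    simp [Algebra.smul_def, mul_comm]
  rw [hsum]
  refine Submodule.sum_mem _ fun t _ => Submodule.smul_mem _ _ (Submodule.subset_span ⟨_, ?_, rfl⟩)
  refine hW _ fun j => ?_
  have h1 : ∑ i, M i j • x i = 0 := by
    rw [← hx j]
    exact Finset.sum_congr rfl fun i _ => by simp [Algebra.smul_def, mul_comm]
  have h2 := congrArg (fun y => e.repr y t) h1
  simp only [map_sum, map_smul, map_zero, Finsupp.coe_finsetSum, Finset.sum_apply,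
    Finsupp.coe_smul, Pi.smul_apply, smul_eq_mul, Finsupp.coe_zero, Pi.zero_apply] at h2
  rw [← h2]
  exact Finset.sum_congr rfl fun i _ => mul_comm _ _

end BaseChange

section AlgHullSpan

variable {K : Type*} [Field K] [Algebra ℝ K]

/-- A vector in the span of a subspace defined over a subfield of the hull of `T₀` has its coordinates in the
hull of `T₀` and of as many elements as the dimension of the subspace. -/
lemma exists_finset_mem_algHull_of_mem_span [DecidableEq K] {T₀ : Finset K}
    {L : IntermediateField ℝ K} (hL : L ≤ algHull ℝ (T₀ : Set K)) {n : ℕ}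
    (W : Submodule L (Fin n → L)) {x : Fin n → K}
    (hx : x ∈ Submodule.span K (inclPi L n '' W)) :
    ∃ C : Finset K, C.card ≤ Module.finrank L W ∧
      ∀ i, x i ∈ algHull ℝ ((T₀ ∪ C : Finset K) : Set K) := by
  let b := Module.finBasis L W
  have h1 : x ∈ Submodule.span K (range fun j => inclPi L n (b j)) := by
    refine (Submodule.span_le.2 ?_ : Submodule.span K (inclPi L n '' W) ≤ _) hx
    rintro _ ⟨y, hy, rfl⟩
    have h2 : y = ∑ j, b.repr ⟨y, hy⟩ j • (b j : Fin n → L) := by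
      have := congrArg W.subtype (b.sum_repr ⟨y, hy⟩)
      rw [map_sum] at this
      exact this.symm
    rw [h2, map_sum]
    refine Submodule.sum_mem _ fun j _ => ?_
    have h3 : inclPi L n (b.repr ⟨y, hy⟩ j • (b j : Fin n → L)) =
        (b.repr ⟨y, hy⟩ j : K) • inclPi L n (b j) := by
      ext i; simp
    rw [h3]
    exact Submodule.smul_mem _ _ (Submodule.subset_span ⟨j, rfl⟩)
  obtain ⟨t, rfl⟩ := (Submodule.mem_span_range_iff_exists_fun K).1 h1
  refine ⟨Finset.univ.image t, Finset.card_image_le.trans (by simp), fun i => ?_⟩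
  rw [Finset.sum_apply]
  refine sum_mem fun j _ => mul_mem (subset_algHull _ (by simp)) ?_
  exact algHull_mono (by simp) (hL ((b j : Fin n → L) i).2)

end AlgHullSpan

/-! ### Generic points of the union of the radicals -/

section Core

variable {r s : ℕ} {c : Fin r → Fin r → Fin s → ℝ} {K : Type*} [Field K] [Algebra ℝ K]

lemma inclPi_structureMap (L : IntermediateField ℝ K) (x y : Fin r → L) :
    inclPi L s (structureMap c L x y) = structureMap c K (inclPi L r x) (inclPi L r y) := by
  ext k
  simp [structureMap_apply]

/-- The radical is cut out by linear equations with coefficients in L, so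
`mem_span_image_of_sum_eq_zero` applies. -/
lemma mem_span_image_ker_structureForm (L : IntermediateField ℝ K) (l : Fin s → L)
    {x : Fin r → K} (hx : structureForm c (inclPi L s l) x = 0) :
    x ∈ Submodule.span K (inclPi L r '' (LinearMap.ker (structureForm c l) :
      Submodule L (Fin r → L))) := by
  refine mem_span_image_of_sum_eq_zero L (fun i j => ∑ k, l k * algebraMap ℝ L (c i j k)) _
    (fun y hy => ?_) fun j => ?_
  · rw [SetLike.mem_coe, LinearMap.mem_ker]
    refine (Pi.basisFun L (Fin r)).ext fun j => ?_
    conv_lhs => rw [pi_eq_sum_univ' y]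
    rw [LinearMap.zero_apply, ← hy j, map_sum, LinearMap.sum_apply]
    simp [structureForm_single]
  · have := LinearMap.congr_fun hx (Pi.single j 1)
    rw [pi_eq_sum_univ' x, map_sum, LinearMap.sum_apply] at this
    rw [LinearMap.zero_apply] at this
    rw [← this]
    simp [structureForm_single]

lemma structureMap_mem_span_image (L : IntermediateField ℝ K) {W : Submodule L (Fin r → L)}
    {x y : Fin r → K} (hx : x ∈ Submodule.span K (inclPi L r '' W))
    (hy : y ∈ Submodule.span K (inclPi L r '' W)) :
    structureMap c K x y ∈ Submodule.span K (inclPi L s '' (spanValues (structureMap c L) W :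
      Submodule L (Fin s → L))) := by
  refine LinearMap.BilinMap.apply_apply_mem_of_mem_span _ _ _ (structureMap c K) ?_ x y hx hy
  rintro _ ⟨a, ha, rfl⟩ _ ⟨b, hb, rfl⟩
  rw [← inclPi_structureMap]
  exact Submodule.subset_span ⟨_, Submodule.subset_span ⟨a, ha, b, hb, rfl⟩, rfl⟩

/-- If the radical `W` of the form with coefficients `l` has vectors with coordinates in `L`, and
`L` is in the hull of `T₀`, then the points of `W × [W, W]` are in the hull of
`|T₀| + dim W + dim [W, W]` elements. -/
lemma exists_finset_mem_algHull_of_mem_ker {T₀ : Finset K} {L : IntermediateField ℝ K}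
    (hL : L ≤ algHull ℝ (T₀ : Set K)) (l : Fin s → L) {x : Fin r → K}
    (hx : structureForm c (inclPi L s l) x = 0) {ι : Type*} [Fintype ι] {u v : ι → Fin r → K}
    (hu : ∀ i, structureForm c (inclPi L s l) (u i) = 0)
    (hv : ∀ i, structureForm c (inclPi L s l) (v i) = 0) :
    ∃ T : Finset K, T.card ≤ T₀.card + Module.finrank L (LinearMap.ker (structureForm c l)) +
        Module.finrank L (spanValues (structureMap c L) (LinearMap.ker (structureForm c l))) ∧
      (∀ i, x i ∈ algHull ℝ (T : Set K)) ∧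
      ∀ k, (∑ i, structureMap c K (u i) (v i)) k ∈ algHull ℝ (T : Set K) := by
  classical
  obtain ⟨C, hC, hxC⟩ := exists_finset_mem_algHull_of_mem_span hL _
    (mem_span_image_ker_structureForm L l hx)
  -- The whole sum is one vector in the extension of [W, W] to K, so its cost is dim [W, W] however
  -- many brackets it has.
  obtain ⟨D, hD, hzD⟩ := exists_finset_mem_algHull_of_mem_span hL _
    (Submodule.sum_mem _ fun i (_ : i ∈ Finset.univ) => structureMap_mem_span_image (c := c) L
      (mem_span_image_ker_structureForm L l (hu i)) (mem_span_image_ker_structureForm L l (hv i)))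
  refine ⟨T₀ ∪ C ∪ D, ?_, fun i => algHull_mono ?_ (hxC i), fun k => algHull_mono ?_ (hzD k)⟩
  · have h1 := Finset.card_union_le (T₀ ∪ C) D
    have h2 := Finset.card_union_le T₀ C
    omega
  · exact_mod_cast Finset.subset_union_left
  · exact_mod_cast Finset.union_subset_union_left Finset.subset_union_left

/-- The dimension count: in total dimension at most seven, the transcendence degree of a point of
the union of the sets `W × [W, W]`, where `W` is the radical of a nonzero form, is at most the total
dimension minus three. -/
theorem exists_finset_card_add_three_le (hrs : r + s ≤ 7) (hc : ∀ i j k, c i j k = - c j i k)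
    {i₀ : Fin s} {l : Fin s → K} (hl : l i₀ = 1) (hne : structureForm c l ≠ 0) {x : Fin r → K}
    (hx : structureForm c l x = 0) {ι : Type*} [Fintype ι] {u v : ι → Fin r → K}
    (hu : ∀ i, structureForm c l (u i) = 0) (hv : ∀ i, structureForm c l (v i) = 0) :
    ∃ T : Finset K, T.card + 3 ≤ r + s ∧ (∀ i, x i ∈ algHull ℝ (T : Set K)) ∧
      ∀ k, (∑ i, structureMap c K (u i) (v i)) k ∈ algHull ℝ (T : Set K) := by
  classical
  have hJcard : (Finset.univ.erase i₀ : Finset (Fin s)).card = s - 1 := by simp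
  have hs : 0 < s := i₀.pos
  -- The coordinate 1 at i₀ costs nothing. If the other s − 1 coordinates are dependent, one is
  -- algebraic over the rest and is dropped, leaving s − 2.
  obtain ⟨T₀, hlT, hT₀⟩ : ∃ T₀ : Finset K, (∀ k, l k ∈ algHull ℝ (T₀ : Set K)) ∧
      (T₀.card + 2 ≤ s ∨ T₀.card + 1 ≤ s ∧
        AlgebraicIndepOn ℝ l ((Finset.univ.erase i₀ : Finset (Fin s)) : Set (Fin s))) := by
    by_cases hind : AlgebraicIndepOn ℝ l ((Finset.univ.erase i₀ : Finset (Fin s)) : Set (Fin s))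
    · refine ⟨(Finset.univ.erase i₀).image l, fun k => ?_, Or.inr ⟨?_, hind⟩⟩
      · by_cases hk : k = i₀
        · rw [hk, hl]; exact one_mem _
        · exact subset_algHull _ (Finset.mem_coe.2 (Finset.mem_image_of_mem _ (by simp [hk])))
      · have := Finset.card_image_le (s := Finset.univ.erase i₀) (f := l)
        omega
    · obtain ⟨j, hj, hmem⟩ := exists_mem_algHull_of_not_algebraicIndepOn hind
      refine ⟨((Finset.univ.erase i₀).erase j).image l, fun k => ?_, Or.inl ?_⟩
      · by_cases hk : k = i₀
        · rw [hk, hl]; exact one_mem _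
        by_cases hkj : k = j
        · rw [hkj]
          refine algHull_mono ?_ hmem
          rw [Finset.coe_image, Finset.coe_erase j]
        · exact subset_algHull _ (Finset.mem_coe.2 (Finset.mem_image_of_mem _ (by simp [hk, hkj])))
      · have h1 := Finset.card_image_le (s := (Finset.univ.erase i₀).erase j) (f := l)
        have h2 := Finset.card_erase_of_mem hj
        have h3 := Finset.card_pos.2 ⟨j, hj⟩
        omega
  obtain ⟨L, hL⟩ : ∃ L, L = algHull ℝ (T₀ : Set K) := ⟨_, rfl⟩
  rw [← hL] at hlT
  let l' : Fin s → L := fun k => ⟨l k, hlT k⟩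
  have hl' : inclPi L s l' = l := rfl
  rw [← hl'] at hx hu hv hne
  obtain ⟨T, hT, hxT, hzT⟩ := exists_finset_mem_algHull_of_mem_ker (c := c) hL.le l' hx hu hv
  refine ⟨T, ?_, hxT, hzT⟩
  have hchar : CharZero L := algebraRat.charZero L
  have halt := structureForm_isAlt hc l'
  have hform (x y : Fin r → L) : (structureForm c l' x y : K) =
      structureForm c (inclPi L s l') (inclPi L r x) (inclPi L r y) := by
    rw [structureForm_apply, structureForm_apply, ← inclPi_structureMap]
    simp
  obtain ⟨i, j, hij⟩ : ∃ i j, structureForm c l' (Pi.single i 1) (Pi.single j 1) ≠ 0 := by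
    by_contra! h
    refine hne ((Pi.basisFun K (Fin r)).ext fun i => (Pi.basisFun K (Fin r)).ext fun j => ?_)
    have h1 := congrArg (algebraMap L K) (h i j)
    rw [structureForm_single] at h1
    simp only [Pi.basisFun_apply, structureForm_single, LinearMap.zero_apply]
    rw [← map_zero (algebraMap L K), ← h1]
    simp
  -- The bounds for the count: dim W ≤ r − 2, dim [W, W] ≤ s − 1, and dim [W, W] ≤ 1 if dim W ≤ 2.
  have hk2 := finrank_ker_add_two_le halt hij
  have hd1 := finrank_spanValues_ker_lt (structureMap c L) (l := dotFunctional l') fun h0 =>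
    hij (by simp [structureForm, h0])
  have hd2 := finrank_spanValues_le_one (structureMap_isAlt hc L)
    (W := LinearMap.ker (structureForm c l'))
  change Module.finrank L (spanValues (structureMap c L) (LinearMap.ker (structureForm c l'))) < _
    at hd1
  rw [Module.finrank_fin_fun] at hk2 hd1
  by_cases hpf : ∀ a b p q, pfaffian (structureForm c l') (Pi.single a 1) (Pi.single b 1)
      (Pi.single p 1) (Pi.single q 1) = 0
  · obtain hT₀ | ⟨hT₀, hind⟩ := hT₀
    -- Rank 2 with dependent coefficients: dim [W, W] ≤ 1, by hd1 if s ≤ 2, and by hd2 if s ≥ 3,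
    -- since then r ≤ 4 and dim W ≤ 2. The total is (s − 2) + (r − 2) + 1.
    · omega
    · have hgen {m : Fin s → L} (hm : m i₀ = 1) (a b x y : Fin r → L) :
          pfaffian (structureForm c m) a b x y = 0 := by
        refine pfaffian_structureForm_eq_zero_of_generic c hl hind (fun a b p q => ?_) hm a b x y
        have hsingle (i : Fin r) : (Pi.single i 1 : Fin r → K) = inclPi L r (Pi.single i 1) := by
          ext j
          by_cases h : j = i <;> simp [h]
        have h1 := congrArg (algebraMap L K) (hpf a b p q)
        rw [map_zero] at h1
        rw [← h1, ← hl']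
        simp only [pfaffian, hsingle, ← hform]
        simp
      have hD : spanValues (structureMap c L) (LinearMap.ker (structureForm c l')) = ⊥ := by
        refine (Submodule.span_eq_bot).2 ?_
        rintro _ ⟨w, hw, w', hw', rfl⟩
        have hzero (y : Fin r → L) : dotFunctional l' (structureMap c L y w') = 0 := by
          have h1 : structureForm c l' w' y = 0 := by rw [LinearMap.mem_ker.1 hw']; rfl
          have h2 : structureForm c l' y w' = 0 := by rw [← halt.neg, h1, neg_zero]
          exact h2
        have hzero' (y : Fin r → L) : dotFunctional l' (structureMap c L y w) = 0 := by
          have h1 : structureForm c l' w y = 0 := by rw [LinearMap.mem_ker.1 hw]; rfl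
          have h2 : structureForm c l' y w = 0 := by rw [← halt.neg, h1, neg_zero]
          exact h2
        -- For k ≠ i₀ the functionals l ± eₖ still have coordinate 1 at i₀, so hgen applies to both.
        have hne' (k : Fin s) (hk : k ≠ i₀) : structureMap c L w w' k = 0 := by
          have hadd : dotFunctional (l' + Pi.single k 1) =
              dotFunctional l' + (LinearMap.proj k : (Fin s → L) →ₗ[L] L) := by
            refine LinearMap.ext fun z => ?_
            simp [dotFunctional_apply, add_mul, Finset.sum_add_distrib, Pi.single_apply]
          have hsub : dotFunctional (l' - Pi.single k 1) =
              dotFunctional l' - (LinearMap.proj k : (Fin s → L) →ₗ[L] L) := by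
            refine LinearMap.ext fun z => ?_
            simp [dotFunctional_apply, sub_mul, Finset.sum_sub_distrib, Pi.single_apply]
          have h1 : l' i₀ = 1 := Subtype.ext hl
          refine apply_apply_eq_zero_of_pfaffian (l := dotFunctional l') (m := LinearMap.proj k)
            hij ?_ ?_ hzero' hzero
          · rw [← hadd]
            exact hgen (by simp [h1, hk.symm]) _ _ _ _
          · rw [← hsub]
            exact hgen (by simp [h1, hk.symm]) _ _ _ _
        ext k
        by_cases hk : k = i₀
        -- The remaining coordinate vanishes because l kills the bracket and has coefficient 1
        -- there.
        · subst hk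
          have h1 := hzero w
          rw [dotFunctional_apply, Finset.sum_eq_single k (fun j _ hj => by rw [hne' j hj, mul_zero])
            (by simp)] at h1
          have h2 : l' k = 1 := Subtype.ext hl
          rw [h2, one_mul] at h1
          rw [h1]; rfl
        · rw [hne' k hk]; rfl
      rw [hD, finrank_bot] at hT
      omega
  · push Not at hpf
    obtain ⟨a, b, p, q, hpf⟩ := hpf
    -- Rank at least 4 forces r ≥ 4, hence s ≤ 3 and dim [W, W] ≤ s − 1 ≤ 2. The total is (s − 1) +
    -- (r − 4) + 2.
    have := finrank_ker_add_four_le halt hpf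
    rw [Module.finrank_fin_fun] at this
    omega

end Core

/-! ### The differential of the endpoint map -/

lemma integral_congr_of_ae_Icc {E : Type*} [NormedAddCommGroup E] [NormedSpace ℝ E] {f h : ℝ → E}
    (hfh : f =ᵐ[volume.restrict (Icc (0 : ℝ) 1)] h) {t : ℝ} (ht : t ∈ Icc (0 : ℝ) 1) :
    ∫ s in (0 : ℝ)..t, f s = ∫ s in (0 : ℝ)..t, h s := by
  rw [intervalIntegral.integral_of_le ht.1, intervalIntegral.integral_of_le ht.1]
  have hsub : Ioc 0 t ⊆ Icc (0 : ℝ) 1 := fun x hx => ⟨hx.1.le, hx.2.trans ht.2⟩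
  exact integral_congr_ae (ae_restrict_of_ae_restrict_of_subset hsub hfh)

/-- Meant for a bilinear expression in two bounded absolutely continuous curves, whose increments
are controlled by those of the factors. -/
lemma AbsolutelyContinuousOnInterval.of_dist_le_add {X Y Z : Type*} [PseudoMetricSpace X]
    [PseudoMetricSpace Y] [PseudoMetricSpace Z] {f : ℝ → X} {h : ℝ → Y} {k : ℝ → Z} {a b C : ℝ}
    (hh : AbsolutelyContinuousOnInterval h a b) (hk : AbsolutelyContinuousOnInterval k a b)
    (hle : ∀ x ∈ uIcc a b, ∀ y ∈ uIcc a b,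
      dist (f x) (f y) ≤ C * (dist (h x) (h y) + dist (k x) (k y))) :
    AbsolutelyContinuousOnInterval f a b := by
  refine squeeze_zero' (Filter.Eventually.of_forall fun E =>
    Finset.sum_nonneg fun i _ => dist_nonneg) ?_
    (by simpa using Filter.Tendsto.const_mul C (Filter.Tendsto.add hh hk))
  filter_upwards [Filter.mem_inf_of_right (Filter.mem_principal_self _)] with E hE
  rw [← Finset.sum_add_distrib, Finset.mul_sum]
  exact Finset.sum_le_sum fun i hi => hle _ (hE.1 i hi).1 _ (hE.1 i hi).2

namespace StepTwoStratification

noncomputable section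

variable {g : Type*} [NormedRealLieAlgebra g] {S : StepTwoStratification g}

/-- A control, with values in the tangent space of the group at the identity. -/
def velocity (u : S.Control) (t : ℝ) : S.CarnotGroup := CarnotGroup.exp S (u t)

/-- The primitive of a control. -/
def primitive (u : S.Control) (t : ℝ) : S.CarnotGroup := ∫ s in (0 : ℝ)..t, velocity u s

lemma norm_velocity (u : S.Control) (t : ℝ) : ‖velocity u t‖ = ‖u t‖ :=
  (CarnotGroup.exp S).norm_map (u t)

lemma velocity_integrable (u : S.Control) :
    Integrable (velocity u) (volume.restrict (Icc (0 : ℝ) 1)) :=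
  (((CarnotGroup.exp S).toContinuousLinearEquiv.toContinuousLinearMap).comp
    S.V₁.subtypeL).integrable_comp ((Lp.memLp u).integrable one_le_two)

lemma velocity_intervalIntegrable (u : S.Control) :
    IntervalIntegrable (velocity u) volume 0 1 := by
  rw [intervalIntegrable_iff_integrableOn_Icc_of_le zero_le_one]
  exact velocity_integrable u

lemma velocity_intervalIntegrable_of_mem (u : S.Control) {t : ℝ} (ht : t ∈ Icc (0 : ℝ) 1) :
    IntervalIntegrable (velocity u) volume 0 t :=
  (velocity_intervalIntegrable u).mono_set
    (uIcc_subset_uIcc_left (by rwa [uIcc_of_le zero_le_one]))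

/-- On a probability space the L¹ norm is at most the L² norm. -/
lemma integral_norm_velocity_le (u : S.Control) : ∫ t in Icc (0 : ℝ) 1, ‖velocity u t‖ ≤ ‖u‖ := by
  have : IsProbabilityMeasure (volume.restrict (Icc (0 : ℝ) 1)) := ⟨by simp⟩
  simp only [norm_velocity]
  rw [Lp.norm_def, integral_norm_eq_lintegral_enorm (Lp.aestronglyMeasurable u),
    ← eLpNorm_one_eq_lintegral_enorm]
  exact ENNReal.toReal_mono (Lp.eLpNorm_ne_top u)
    (eLpNorm_le_eLpNorm_of_exponent_le one_le_two (Lp.aestronglyMeasurable u))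

lemma velocity_add (u v : S.Control) : velocity (u + v) =ᵐ[volume.restrict (Icc (0 : ℝ) 1)]
    fun t => velocity u t + velocity v t := by
  filter_upwards [Lp.coeFn_add u v] with t ht
  simp only [velocity, ht, Pi.add_apply, Submodule.coe_add, map_add]

lemma velocity_smul (c : ℝ) (u : S.Control) :
    velocity (c • u) =ᵐ[volume.restrict (Icc (0 : ℝ) 1)] fun t => c • velocity u t := by
  filter_upwards [Lp.coeFn_smul c u] with t ht
  simp only [velocity, ht, Pi.smul_apply, Submodule.coe_smul, map_smul]

lemma primitive_absolutelyContinuous (u : S.Control) :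
    AbsolutelyContinuousOnInterval (primitive u) 0 1 :=
  (velocity_intervalIntegrable u).absolutelyContinuousOnInterval_integral

lemma primitive_continuousOn (u : S.Control) : ContinuousOn (primitive u) (Icc 0 1) := by
  have := (primitive_absolutelyContinuous u).continuousOn
  rwa [uIcc_of_le zero_le_one] at this

@[simp] lemma primitive_zero (u : S.Control) : primitive u 0 = 0 := by simp [primitive]

lemma primitive_one (u : S.Control) : primitive u 1 = ∫ t in Icc (0 : ℝ) 1, velocity u t := by
  rw [primitive, intervalIntegral.integral_of_le zero_le_one, integral_Icc_eq_integral_Ioc]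

lemma primitive_add (u v : S.Control) {t : ℝ} (ht : t ∈ Icc (0 : ℝ) 1) :
    primitive (u + v) t = primitive u t + primitive v t := by
  rw [primitive, integral_congr_of_ae_Icc (velocity_add u v) ht]
  exact intervalIntegral.integral_add (velocity_intervalIntegrable_of_mem u ht)
    (velocity_intervalIntegrable_of_mem v ht)

lemma primitive_smul (c : ℝ) (u : S.Control) {t : ℝ} (ht : t ∈ Icc (0 : ℝ) 1) :
    primitive (c • u) t = c • primitive u t := by
  rw [primitive, integral_congr_of_ae_Icc (velocity_smul c u) ht]
  exact intervalIntegral.integral_smul c _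

lemma norm_primitive_le (u : S.Control) {t : ℝ} (ht : t ∈ Icc (0 : ℝ) 1) :
    ‖primitive u t‖ ≤ ‖u‖ := by
  refine le_trans ?_ (integral_norm_velocity_le u)
  rw [primitive, intervalIntegral.integral_of_le ht.1]
  refine (norm_integral_le_integral_norm _).trans ?_
  have hsub : Ioc 0 t ⊆ Icc (0 : ℝ) 1 := fun x hx => ⟨hx.1.le, hx.2.trans ht.2⟩
  exact setIntegral_mono_set (velocity_integrable u).norm
    (Filter.Eventually.of_forall fun _ => norm_nonneg _) (Filter.Eventually.of_forall hsub)

variable (S) in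
/-- The linear part of the endpoint map. -/
def endpointLinear : S.Control →L[ℝ] S.CarnotGroup :=
  LinearMap.mkContinuous
    { toFun := fun u => primitive u 1
      map_add' := fun u v => primitive_add u v (right_mem_Icc.2 zero_le_one)
      map_smul' := fun c u => primitive_smul c u (right_mem_Icc.2 zero_le_one) } 1
    fun u => by simpa using norm_primitive_le u (right_mem_Icc.2 zero_le_one)

lemma endpointLinear_apply (u : S.Control) : S.endpointLinear u = primitive u 1 := rfl

variable [FiniteDimensional ℝ g]

lemma ae_hasDerivAt_primitive (u : S.Control) :
    ∀ᵐ t, t ∈ Icc (0 : ℝ) 1 → HasDerivAt (primitive u) (velocity u t) t := by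
  filter_upwards [(velocity_intervalIntegrable u).ae_hasDerivAt_integral] with t ht ht01
  rw [← uIcc_of_le (zero_le_one' ℝ)] at ht01
  exact ht ht01 0 left_mem_uIcc

/-- The bracket of the primitive of a control and another control. -/
def liePrimitive (u v : S.Control) (t : ℝ) : S.CarnotGroup :=
  CarnotGroup.lieL S (primitive u t) (velocity v t)

lemma ae_norm_liePrimitive_le (u v : S.Control) : ∀ᵐ t ∂(volume.restrict (Icc (0 : ℝ) 1)),
    ‖liePrimitive u v t‖ ≤ ‖CarnotGroup.lieL S‖ * ‖u‖ * ‖velocity v t‖ := by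
  filter_upwards [ae_restrict_mem measurableSet_Icc] with t ht
  refine ((CarnotGroup.lieL S).le_opNorm₂ _ _).trans ?_
  gcongr
  exact norm_primitive_le u ht

lemma liePrimitive_integrable (u v : S.Control) :
    Integrable (liePrimitive u v) (volume.restrict (Icc (0 : ℝ) 1)) :=
  ((velocity_integrable v).norm.const_mul _).mono'
    ((CarnotGroup.lieL S).aestronglyMeasurable_comp₂
      ((primitive_continuousOn u).aestronglyMeasurable measurableSet_Icc)
      (velocity_integrable v).aestronglyMeasurable)
    (ae_norm_liePrimitive_le u v)

lemma liePrimitive_intervalIntegrable (u v : S.Control) :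
    IntervalIntegrable (liePrimitive u v) volume 0 1 := by
  rw [intervalIntegrable_iff_integrableOn_Icc_of_le zero_le_one]
  exact liePrimitive_integrable u v

variable (S) in
/-- The quadratic part of the endpoint map, as a bilinear map. -/
def endpointBilinear : S.Control →L[ℝ] S.Control →L[ℝ] S.CarnotGroup :=
  LinearMap.mkContinuous₂
    (LinearMap.mk₂ ℝ
      (fun u v => ∫ t in Icc (0 : ℝ) 1, liePrimitive u v t)
      (fun u u' v => by
        rw [← integral_add (liePrimitive_integrable u v) (liePrimitive_integrable u' v)]
        refine setIntegral_congr_fun measurableSet_Icc fun t ht => ?_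
        simp [liePrimitive, primitive_add u u' ht])
      (fun c u v => by
        rw [← integral_smul]
        refine setIntegral_congr_fun measurableSet_Icc fun t ht => ?_
        simp [liePrimitive, primitive_smul c u ht])
      (fun u v v' => by
        rw [← integral_add (liePrimitive_integrable u v) (liePrimitive_integrable u v')]
        refine integral_congr_ae ?_
        filter_upwards [velocity_add v v'] with t ht
        simp [liePrimitive, ht])
      (fun c u v => by
        rw [← integral_smul]
        refine integral_congr_ae ?_
        filter_upwards [velocity_smul c v] with t ht
        simp [liePrimitive, ht])) ‖CarnotGroup.lieL S‖ fun u v => by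
    refine (norm_integral_le_of_norm_le ((velocity_integrable v).norm.const_mul _)
      (ae_norm_liePrimitive_le u v)).trans ?_
    rw [integral_const_mul]
    exact mul_le_mul_of_nonneg_left (integral_norm_velocity_le v) (by positivity)

lemma endpointBilinear_apply (u v : S.Control) : S.endpointBilinear u v =
    ∫ t in Icc (0 : ℝ) 1, liePrimitive u v t := rfl

/-- The explicit form of the horizontal curves. -/
lemma isHorizontalCurve_primitive (u : S.Control) : S.IsHorizontalCurve u fun t =>
    primitive u t + (1 / 2 : ℝ) • ∫ s in (0 : ℝ)..t, liePrimitive u u s where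
  absolutelyContinuous := by
    refine (primitive_absolutelyContinuous u).fun_add ?_
    refine ((liePrimitive_intervalIntegrable
      u u).absolutelyContinuousOnInterval_integral).of_dist_le (C := ‖(1 / 2 : ℝ)‖)
        fun s _ t _ => ?_
    rw [dist_smul₀]
  init := by simp [CarnotGroup.one_def]
  ode := by
    rw [ae_restrict_iff' measurableSet_Icc]
    filter_upwards [ae_hasDerivAt_primitive u,
      (liePrimitive_intervalIntegrable u u).ae_hasDerivAt_integral] with t ht ht' ht01
    have h2 := (ht' (by rwa [uIcc_of_le zero_le_one]) 0 left_mem_uIcc).const_smul (1 / 2 : ℝ)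
    refine ((ht ht01).add h2).congr_deriv ?_
    rw [CarnotGroup.fderiv_mul_left, add_lie, smul_lie]
    -- The second-layer part of the curve is central, because double brackets vanish.
    have h0 : ⁅∫ s in (0 : ℝ)..t, liePrimitive u u s, CarnotGroup.exp S (u t)⁆ = 0 := by
      rw [← CarnotGroup.lieL_apply, ← ContinuousLinearMap.flip_apply,
        ← ContinuousLinearMap.intervalIntegral_comp_comm _
          ((liePrimitive_intervalIntegrable u u).mono_set
            (uIcc_subset_uIcc_left (by rwa [uIcc_of_le zero_le_one])))]
      simp [liePrimitive, CarnotGroup.lie_lie_eq_zero', -lie_lie]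
    rw [h0, smul_zero, add_zero]
    rfl

lemma endpoint_eq (u : S.Control) : S.endpoint u =
    S.endpointLinear u + (1 / 2 : ℝ) • S.endpointBilinear u u := by
  rw [(isHorizontalCurve_primitive u).endpoint_eq, endpointBilinear_apply, endpointLinear_apply,
    integral_Icc_eq_integral_Ioc, intervalIntegral.integral_of_le zero_le_one]

/-- Integration by parts. -/
lemma endpointBilinear_swap (u v : S.Control) : S.endpointBilinear v u =
    S.endpointBilinear u v - CarnotGroup.lieL S (primitive u 1) (primitive v 1) := by
  have huv := liePrimitive_intervalIntegrable u v
  have hvu := liePrimitive_intervalIntegrable v u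
  -- Γ is the bracket of the primitives minus the integral of its derivative: it is absolutely
  -- continuous with zero derivative almost everywhere, hence constant.
  let Γ : ℝ → S.CarnotGroup := fun t => CarnotGroup.lieL S (primitive u t) (primitive v t) -
    ∫ s in (0 : ℝ)..t, (liePrimitive u v s - liePrimitive v u s)
  have hac : AbsolutelyContinuousOnInterval Γ 0 1 := by
    refine AbsolutelyContinuousOnInterval.fun_sub ?_
      (huv.sub hvu).absolutelyContinuousOnInterval_integral
    refine (primitive_absolutelyContinuous u).of_dist_le_add (primitive_absolutelyContinuous v)
      (C := ‖CarnotGroup.lieL S‖ * (‖u‖ + ‖v‖)) fun s hs t ht => ?_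
    rw [uIcc_of_le zero_le_one] at hs ht
    have h1 : CarnotGroup.lieL S (primitive u s) (primitive v s) -
        CarnotGroup.lieL S (primitive u t) (primitive v t) =
        CarnotGroup.lieL S (primitive u s - primitive u t) (primitive v s) +
          CarnotGroup.lieL S (primitive u t) (primitive v s - primitive v t) := by
      simp only [map_sub, sub_apply]
      abel
    simp only [dist_eq_norm]
    rw [h1]
    calc _ ≤ ‖CarnotGroup.lieL S‖ * ‖primitive u s - primitive u t‖ * ‖primitive v s‖ +
          ‖CarnotGroup.lieL S‖ * ‖primitive u t‖ * ‖primitive v s - primitive v t‖ :=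
        (norm_add_le _ _).trans (add_le_add ((CarnotGroup.lieL S).le_opNorm₂ _ _)
          ((CarnotGroup.lieL S).le_opNorm₂ _ _))
      _ ≤ ‖CarnotGroup.lieL S‖ * ‖primitive u s - primitive u t‖ * (‖u‖ + ‖v‖) +
          ‖CarnotGroup.lieL S‖ * (‖u‖ + ‖v‖) * ‖primitive v s - primitive v t‖ := by
        gcongr
        · linarith [norm_primitive_le v hs, norm_nonneg u]
        · linarith [norm_primitive_le u ht, norm_nonneg v]
      _ = _ := by ring
  obtain ⟨C, hC⟩ := hac.const_of_ae_hasDerivAt_zero (by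
    filter_upwards [ae_hasDerivAt_primitive u, ae_hasDerivAt_primitive v,
      (huv.sub hvu).ae_hasDerivAt_integral] with t htu htv ht ht01
    have ht01' := ht01
    rw [uIcc_of_le zero_le_one] at ht01'
    have h1 := (CarnotGroup.lieL S).hasFDerivAt.comp_hasDerivAt t (htu ht01')
    have h2 := (h1.clm_apply (htv ht01')).sub (ht ht01 0 left_mem_uIcc)
    refine h2.congr_deriv ?_
    simp only [liePrimitive, Function.comp_apply, CarnotGroup.lieL_apply]
    rw [← lie_skew (primitive v t) (velocity u t)]
    abel)
  have h0 := hC 0 left_mem_uIcc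
  have h1 := hC 1 right_mem_uIcc
  rw [← h0] at h1
  simp only [Γ, primitive_zero, map_zero, intervalIntegral.integral_same, sub_zero,
    intervalIntegral.integral_sub huv hvu] at h1
  rw [endpointBilinear_apply, endpointBilinear_apply, integral_Icc_eq_integral_Ioc,
    integral_Icc_eq_integral_Ioc, ← intervalIntegral.integral_of_le zero_le_one,
    ← intervalIntegral.integral_of_le zero_le_one]
  have h2 := sub_eq_zero.1 h1
  rw [h2]
  abel

lemma hasFDerivAt_endpoint (u : S.Control) : HasFDerivAt S.endpoint
    (S.endpointLinear + (1 / 2 : ℝ) • (S.endpointBilinear u + S.endpointBilinear.flip u)) u := by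
  have h : S.endpoint = fun u => S.endpointLinear u +
      (1 / 2 : ℝ) • S.endpointBilinear u u := funext endpoint_eq
  rw [h]
  have h1 := S.endpointBilinear.hasFDerivAt_of_bilinear (hasFDerivAt_id u) (hasFDerivAt_id u)
  exact (S.endpointLinear.hasFDerivAt).add (h1.const_smul (1 / 2 : ℝ))

/-- The differential of the endpoint map. -/
lemma fderiv_endpoint_apply (u v : S.Control) : fderiv ℝ S.endpoint u v =
    primitive v 1 + S.endpointBilinear u v - (1 / 2 : ℝ) • ⁅primitive u 1, primitive v 1⁆ := by
  rw [(hasFDerivAt_endpoint u).fderiv, ← CarnotGroup.lieL_apply]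
  -- The swap removes the primitive of v under the integral sign, so that v enters linearly through
  -- its values, as needed for testing.
  simp only [add_apply, smul_apply, ContinuousLinearMap.flip_apply, endpointLinear_apply,
    endpointBilinear_swap u v]
  module

end

end StepTwoStratification

/-! ### Abnormal curves -/

namespace StepTwoStratification

noncomputable section

section Radical

variable {g : Type*} [LieRing g] [LieAlgebra ℝ g] (S : StepTwoStratification g)

/-- The radical of the alternating form `(a, w) ↦ f [a, w]` on the first layer. -/
def radical (f : g →ₗ[ℝ] ℝ) : Submodule ℝ g where
  carrier := {a | a ∈ S.V₁ ∧ ∀ w ∈ S.V₁, f ⁅a, w⁆ = 0}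
  add_mem' ha hb := ⟨add_mem ha.1 hb.1, fun w hw => by
    rw [add_lie, map_add, ha.2 w hw, hb.2 w hw, add_zero]⟩
  zero_mem' := ⟨zero_mem _, fun w _ => by rw [zero_lie, map_zero]⟩
  smul_mem' c a ha := ⟨S.V₁.smul_mem c ha.1, fun w hw => by
    rw [smul_lie, map_smul, ha.2 w hw, smul_zero]⟩

end Radical

variable {g : Type*} [NormedRealLieAlgebra g] [FiniteDimensional ℝ g] {S : StepTwoStratification g}

lemma log_primitive_mem (u : S.Control) {t : ℝ} (ht : t ∈ Icc (0 : ℝ) 1) :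
    CarnotGroup.log S (primitive u t) ∈ S.V₁ := by
  have hu : IntervalIntegrable u volume 0 t := by
    rw [intervalIntegrable_iff_integrableOn_Ioc_of_le ht.1]
    have hsub : Ioc 0 t ⊆ Icc (0 : ℝ) 1 := fun x hx => ⟨hx.1.le, hx.2.trans ht.2⟩
    exact IntegrableOn.mono_set ((Lp.memLp u).integrable one_le_two) hsub
  have h := (((CarnotGroup.exp S).toContinuousLinearEquiv.toContinuousLinearMap).comp
    S.V₁.subtypeL).intervalIntegral_comp_comm hu
  have h2 : primitive u t = CarnotGroup.exp S ((∫ s in (0 : ℝ)..t, u s : S.V₁) : g) := h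
  rw [h2]
  exact (∫ s in (0 : ℝ)..t, u s : S.V₁).2

/-- The differential of the endpoint map, tested against a linear functional. -/
lemma apply_fderiv_endpoint (F : S.CarnotGroup →L[ℝ] ℝ) (u v : S.Control) :
    F (fderiv ℝ S.endpoint u v) = ∫ t in Icc (0 : ℝ) 1, (F (velocity v t) +
      F ⁅primitive u t, velocity v t⁆ - (1 / 2 : ℝ) * F ⁅primitive u 1, velocity v t⁆) := by
  have h1 : Integrable (fun t => F (velocity v t)) (volume.restrict (Icc (0 : ℝ) 1)) :=
    F.integrable_comp (velocity_integrable v)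
  have h2 : Integrable (fun t => F ⁅primitive u t, velocity v t⁆)
      (volume.restrict (Icc (0 : ℝ) 1)) := F.integrable_comp (liePrimitive_integrable u v)
  have h3 : Integrable (fun t => F ⁅primitive u 1, velocity v t⁆)
      (volume.restrict (Icc (0 : ℝ) 1)) :=
    (F.comp (CarnotGroup.lieL S (primitive u 1))).integrable_comp (velocity_integrable v)
  have h12 : Integrable (fun t => F (velocity v t) + F ⁅primitive u t, velocity v t⁆)
      (volume.restrict (Icc (0 : ℝ) 1)) := h1.add h2
  rw [integral_sub h12 (h3.const_mul _), integral_add h1 h2, integral_const_mul]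
  have e1 := F.integral_comp_comm (velocity_integrable v)
  have e2 : ∫ t in Icc (0 : ℝ) 1, F ⁅primitive u t, velocity v t⁆ = _ :=
    F.integral_comp_comm (liePrimitive_integrable u v)
  have e3 : ∫ t in Icc (0 : ℝ) 1, F ⁅primitive u 1, velocity v t⁆ = _ :=
    (F.comp (CarnotGroup.lieL S (primitive u 1))).integral_comp_comm (velocity_integrable v)
  rw [e1, e2, e3, fderiv_endpoint_apply, endpointBilinear_apply, primitive_one v]
  simp
  rfl

/-- If a functional kills the image of the differential of the endpoint map, then the integrand in
`apply_fderiv_endpoint` vanishes identically. -/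
lemma apply_eq_zero_of_forall_fderiv {F : S.CarnotGroup →L[ℝ] ℝ} {u : S.Control}
    (h : ∀ v, F (fderiv ℝ S.endpoint u v) = 0) (w : S.V₁) {t : ℝ} (ht : t ∈ Icc (0 : ℝ) 1) :
    F (CarnotGroup.exp S w) + F ⁅primitive u t, CarnotGroup.exp S w⁆ -
      (1 / 2 : ℝ) * F ⁅primitive u 1, CarnotGroup.exp S w⁆ = 0 := by
  set φ : ℝ → ℝ := fun t => F (CarnotGroup.exp S w) + F ⁅primitive u t, CarnotGroup.exp S w⁆ -
      (1 / 2 : ℝ) * F ⁅primitive u 1, CarnotGroup.exp S w⁆ with hφ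
  have hcont : ContinuousOn φ (Icc 0 1) := by
    refine (continuousOn_const.add ?_).sub continuousOn_const
    exact (F.comp ((CarnotGroup.lieL S).flip (CarnotGroup.exp S w))).continuous.comp_continuousOn
      (primitive_continuousOn u)
  obtain ⟨C, hC⟩ := isCompact_Icc.exists_bound_of_continuousOn hcont
  -- The test control is φ(t) w itself, which turns the hypothesis into ∫ φ² = 0; continuity of φ
  -- then gives vanishing at every t.
  have hmem : MemLp (fun t => φ t • w) 2 (volume.restrict (Icc (0 : ℝ) 1)) := by
    have hc : ContinuousOn (fun t => φ t • w) (Icc 0 1) := hcont.smul continuousOn_const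
    refine MemLp.of_bound (hc.aestronglyMeasurable measurableSet_Icc)
      (C * ‖w‖) ?_
    filter_upwards [ae_restrict_mem measurableSet_Icc] with t ht
    rw [norm_smul]
    exact mul_le_mul_of_nonneg_right (hC t ht) (norm_nonneg w)
  have h1 := h (hmem.toLp _)
  have h2 : ∫ t in Icc (0 : ℝ) 1, φ t * φ t = 0 := by
    refine Eq.trans ?_ h1
    rw [apply_fderiv_endpoint]
    refine integral_congr_ae ?_
    filter_upwards [hmem.coeFn_toLp] with t ht
    have h3 : velocity (hmem.toLp _) t = φ t • CarnotGroup.exp S w := by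
      simp only [velocity, ht, Submodule.coe_smul, map_smul]
    rw [h3, lie_smul, lie_smul, map_smul, map_smul, map_smul]
    simp only [smul_eq_mul, hφ]
    ring
  have h3 : Integrable (fun t => φ t * φ t) (volume.restrict (Icc (0 : ℝ) 1)) :=
    (hcont.mul hcont).integrableOn_compact isCompact_Icc
  have h4 := (integral_eq_zero_iff_of_nonneg (fun t => mul_self_nonneg (φ t)) h3).1 h2
  have h5 := Measure.eqOn_Icc_of_ae_eq volume (zero_ne_one' ℝ) h4 (hcont.mul hcont)
    continuousOn_const
  exact mul_self_eq_zero.1 (h5 ht)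

/-- The endpoint of an abnormal curve is in the subgroup generated by the radical of a nonzero
form. -/
theorem exists_radical_of_isAbnormal {γ : ℝ → S.CarnotGroup} (h : S.IsAbnormal γ) :
    ∃ f : g →ₗ[ℝ] ℝ, (∃ z ∈ S.V₂, f z ≠ 0) ∧ ∃ x ∈ S.radical f,
      ∃ z ∈ Submodule.span ℝ {z : g | ∃ a ∈ S.radical f, ∃ b ∈ S.radical f, ⁅a, b⁆ = z},
        CarnotGroup.log S (γ 1) = x + z := by
  obtain ⟨u, hγ, hns⟩ := h
  obtain ⟨F', hF0, hF'⟩ := Submodule.exists_le_ker_of_lt_top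
    (LinearMap.range (fderiv ℝ S.endpoint u).toLinearMap)
    (lt_top_iff_ne_top.2 fun hr => hns (LinearMap.range_eq_top.1 hr))
  let F : S.CarnotGroup →L[ℝ] ℝ := LinearMap.toContinuousLinearMap F'
  have hF (v : S.Control) : F (fderiv ℝ S.endpoint u v) = 0 := hF' ⟨v, rfl⟩
  have key (w : S.V₁) {t : ℝ} (ht : t ∈ Icc (0 : ℝ) 1) := apply_eq_zero_of_forall_fderiv hF w ht
  -- The identity at t = 0, where the primitive vanishes; subtracting it from the identity at t
  -- leaves only the bracket with the primitive at t.
  have hinit (w : S.V₁) : F (CarnotGroup.exp S w) =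
      (1 / 2 : ℝ) * F ⁅primitive u 1, CarnotGroup.exp S w⁆ := by
    have := key w (left_mem_Icc.2 zero_le_one)
    rw [primitive_zero, zero_lie, map_zero, add_zero] at this
    exact sub_eq_zero.1 this
  have hrad (w : S.V₁) {t : ℝ} (ht : t ∈ Icc (0 : ℝ) 1) :
      F ⁅primitive u t, CarnotGroup.exp S w⁆ = 0 := by
    have := key w ht
    rw [hinit] at this
    linarith
  let f : g →ₗ[ℝ] ℝ := F' ∘ₗ (CarnotGroup.exp S).toLinearEquiv.toLinearMap
  have hX {t : ℝ} (ht : t ∈ Icc (0 : ℝ) 1) :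
      CarnotGroup.log S (primitive u t) ∈ S.radical f :=
    ⟨log_primitive_mem u ht, fun w hw => hrad ⟨w, hw⟩ ht⟩
  have hu : ∀ᵐ t ∂(volume.restrict (Icc (0 : ℝ) 1)),
      CarnotGroup.log S (velocity u t) ∈ S.radical f := by
    -- At an interior time, hrad holds on a neighbourhood and can be differentiated, which puts the
    -- control itself in the radical.
    rw [restrict_Ioo_eq_restrict_Icc.symm, ae_restrict_iff' measurableSet_Ioo]
    filter_upwards [ae_hasDerivAt_primitive u] with t ht ht01
    refine ⟨(u t).2, fun w hw => ?_⟩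
    have h1 := (F.comp ((CarnotGroup.lieL S).flip (CarnotGroup.exp S w))).hasFDerivAt.comp_hasDerivAt
      t (ht (Ioo_subset_Icc_self ht01))
    have h2 : HasDerivAt (F.comp ((CarnotGroup.lieL S).flip (CarnotGroup.exp S w)) ∘ primitive u)
        0 t := by
      refine (hasDerivAt_const t (0 : ℝ)).congr_of_eventuallyEq ?_
      filter_upwards [Ioo_mem_nhds ht01.1 ht01.2] with s hs
      exact hrad ⟨w, hw⟩ (Ioo_subset_Icc_self hs)
    exact h1.unique h2
  let D := Submodule.span ℝ {z : g | ∃ a ∈ S.radical f, ∃ b ∈ S.radical f, ⁅a, b⁆ = z}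
  let D' : Submodule ℝ S.CarnotGroup := D.comap (CarnotGroup.log S).toLinearEquiv.toLinearMap
  have hint : ∫ t in Icc (0 : ℝ) 1, liePrimitive u u t ∈ D' := by
    have : IsProbabilityMeasure (volume.restrict (Icc (0 : ℝ) 1)) := ⟨by simp⟩
    -- A mean of values in a closed convex set, here a finite-dimensional subspace, stays in the
    -- set.
    refine Convex.integral_mem (s := (D' : Set S.CarnotGroup)) D'.convex
      D'.closed_of_finiteDimensional ?_ (liePrimitive_integrable u u)
    filter_upwards [hu, ae_restrict_mem measurableSet_Icc] with t ht ht01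
    exact Submodule.subset_span ⟨_, hX ht01, _, ht, rfl⟩
  refine ⟨f, ?_, _, hX (right_mem_Icc.2 zero_le_one), _,
    D.smul_mem (1 / 2 : ℝ) hint, ?_⟩
  -- If the covector vanished on V₂, hinit would make it vanish on V₁ as well, hence everywhere.
  · by_contra! h0
    refine hF0 (LinearMap.ext fun x => ?_)
    obtain ⟨a, ha, b, hb, hab⟩ := S.exists_decomp (CarnotGroup.log S x)
    have h1 : F (CarnotGroup.exp S a) = 0 := by
      have h2 : F ⁅primitive u 1, CarnotGroup.exp S a⁆ = 0 :=
        h0 _ (S.lie_mem_V₂ (CarnotGroup.log S (primitive u 1)) a)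
      rw [hinit ⟨a, ha⟩, h2, mul_zero]
    have h2 : f (a + b) = 0 := by
      rw [map_add, h0 b hb, add_zero]
      exact h1
    rw [hab] at h2
    exact h2
  · rw [← hγ.endpoint_eq, endpoint_eq, endpointLinear_apply, endpointBilinear_apply]
    rfl

end

end StepTwoStratification

/-! ### Coordinates -/

namespace StepTwoStratification

noncomputable section

section Coordinates

variable {g : Type*} [LieRing g] [LieAlgebra ℝ g] {S : StepTwoStratification g} {r s : ℕ}
  (b₁ : Module.Basis (Fin r) ℝ S.V₁) (b₂ : Module.Basis (Fin s) ℝ S.V₂)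

/-- The structure constants of the bracket of the first layer. -/
def structureConstants (i j : Fin r) (k : Fin s) : ℝ :=
  b₂.repr ⟨⁅(b₁ i : g), (b₁ j : g)⁆, S.lie_mem (b₁ i).2 (b₁ j).2⟩ k

lemma structureConstants_swap (i j : Fin r) (k : Fin s) :
    structureConstants b₁ b₂ i j k = - structureConstants b₁ b₂ j i k := by
  have h : (⟨⁅(b₁ i : g), (b₁ j : g)⁆, S.lie_mem (b₁ i).2 (b₁ j).2⟩ : S.V₂) =
      - ⟨⁅(b₁ j : g), (b₁ i : g)⁆, S.lie_mem (b₁ j).2 (b₁ i).2⟩ :=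
    Subtype.ext (lie_skew _ _).symm
  rw [structureConstants, h, map_neg]
  rfl

lemma sum_repr_smul {V : Submodule ℝ g} {ι : Type*} [Fintype ι] (b : Module.Basis ι ℝ V) {a : g}
    (ha : a ∈ V) : ∑ i, b.repr ⟨a, ha⟩ i • (b i : g) = a := by
  have := congrArg V.subtype (b.sum_repr ⟨a, ha⟩)
  rw [map_sum] at this
  exact this

lemma lie_sum_smul (x y : Fin r → ℝ) :
    ⁅∑ i, x i • (b₁ i : g), ∑ j, y j • (b₁ j : g)⁆ =
      ∑ k, structureMap (structureConstants b₁ b₂) ℝ x y k • (b₂ k : g) := by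
  have h (i j : Fin r) : ⁅(b₁ i : g), (b₁ j : g)⁆ =
      ∑ k, structureConstants b₁ b₂ i j k • (b₂ k : g) :=
    (sum_repr_smul b₂ (S.lie_mem (b₁ i).2 (b₁ j).2)).symm
  simp only [sum_lie, lie_sum, smul_lie, lie_smul, h, structureMap_apply, Finset.sum_smul,
    Finset.smul_sum, smul_smul]
  have hcomm (F : Fin r → Fin r → Fin s → g) :
      ∑ k, ∑ i, ∑ j, F i j k = ∑ i, ∑ j, ∑ k, F i j k := by
    rw [Finset.sum_comm]
    exact Finset.sum_congr rfl fun i _ => Finset.sum_comm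
  rw [hcomm, Finset.sum_comm]
  refine Finset.sum_congr rfl fun i _ => Finset.sum_congr rfl fun j _ =>
    Finset.sum_congr rfl fun k _ => ?_
  rw [Algebra.algebraMap_self_apply]
  congr 1
  ring

lemma apply_lie_sum_smul (f : g →ₗ[ℝ] ℝ) (x y : Fin r → ℝ) :
    f ⁅∑ i, x i • (b₁ i : g), ∑ j, y j • (b₁ j : g)⁆ =
      structureForm (structureConstants b₁ b₂) (fun k => f (b₂ k)) x y := by
  rw [lie_sum_smul b₁ b₂, structureForm_apply, map_sum]
  exact Finset.sum_congr rfl fun k _ => by rw [map_smul, smul_eq_mul, mul_comm]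

/-- The span of the brackets of the elements of a subspace of the first layer consists of sums of
as many brackets as the dimension of the layer. -/
lemma exists_sum_lie_of_mem_span (b₁ : Module.Basis (Fin r) ℝ S.V₁) {W : Submodule ℝ g}
    (hW : W ≤ S.V₁) {z : g}
    (hz : z ∈ Submodule.span ℝ {z : g | ∃ a ∈ W, ∃ b ∈ W, ⁅a, b⁆ = z}) :
    ∃ w v : Fin r → g, (∀ m, w m ∈ W) ∧ (∀ m, v m ∈ W) ∧ z = ∑ m, ⁅w m, v m⁆ := by
  -- P projects onto W. With the left entries fixed as P(b₁ m), the sums of brackets depend linearly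
  -- on v, so the induction on the span closes. The number of brackets is independent of z, as the
  -- later transfer to a field requires.
  obtain ⟨P, hP⟩ := LinearMap.exists_leftInverse_of_injective W.subtype (Submodule.ker_subtype W)
  suffices h : ∃ v : Fin r → g, (∀ m, v m ∈ W) ∧ z = ∑ m, ⁅(P (b₁ m) : g), v m⁆ by
    obtain ⟨v, hv, hz⟩ := h
    exact ⟨fun m => P (b₁ m), v, fun m => (P (b₁ m)).2, hv, hz⟩
  induction hz using Submodule.span_induction with
  | mem z hz =>
    obtain ⟨a, ha, b, hb, rfl⟩ := hz
    refine ⟨fun m => b₁.repr ⟨a, hW ha⟩ m • b, fun m => W.smul_mem _ hb, ?_⟩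
    have h1 : ((P a : W) : g) = a := congrArg W.subtype (LinearMap.congr_fun hP ⟨a, ha⟩)
    have h2 : ∑ m, b₁.repr ⟨a, hW ha⟩ m • (P (b₁ m) : g) = a := by
      conv_rhs => rw [← h1, ← sum_repr_smul b₁ (hW ha)]
      simp
    conv_lhs => rw [← h2]
    simp [sum_lie]
  | zero => exact ⟨fun _ => 0, fun _ => W.zero_mem, by simp⟩
  | add y z _ _ hy hz =>
    obtain ⟨v, hv, rfl⟩ := hy
    obtain ⟨v', hv', rfl⟩ := hz
    exact ⟨fun m => v m + v' m, fun m => add_mem (hv m) (hv' m), by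
      simp [Finset.sum_add_distrib]⟩
  | smul t z _ hz =>
    obtain ⟨v, hv, rfl⟩ := hz
    exact ⟨fun m => t • v m, fun m => W.smul_mem _ (hv m), by simp [Finset.smul_sum]⟩

lemma structureForm_repr_eq_zero {f : g →ₗ[ℝ] ℝ} {a : g} (ha : a ∈ S.radical f) (t : ℝ) :
    structureForm (structureConstants b₁ b₂) (fun k => t * f (b₂ k)) (b₁.repr ⟨a, ha.1⟩) = 0 := by
  refine LinearMap.ext fun y => ?_
  have h1 := apply_lie_sum_smul b₁ b₂ f (b₁.repr ⟨a, ha.1⟩) y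
  rw [sum_repr_smul b₁ ha.1, ha.2 _ (Submodule.sum_mem _ fun j _ =>
    S.V₁.smul_mem _ (b₁ j).2), structureForm_apply] at h1
  rw [structureForm_apply]
  simp only [mul_assoc, ← Finset.mul_sum]
  rw [← h1, mul_zero, LinearMap.zero_apply]

end Coordinates

variable {g : Type*} [NormedRealLieAlgebra g] [FiniteDimensional ℝ g] {S : StepTwoStratification g}
  {r s : ℕ}

/-- The abnormal set in terms of structure constants. -/
theorem exists_structureForm_of_mem_abnormalSet (b₁ : Module.Basis (Fin r) ℝ S.V₁)
    (b₂ : Module.Basis (Fin s) ℝ S.V₂) {p : S.CarnotGroup} (hp : p ∈ S.abnormalSet) :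
    ∃ (i₀ : Fin s) (l : Fin s → ℝ) (x : Fin r → ℝ) (w v : Fin r → Fin r → ℝ), l i₀ = 1 ∧
      structureForm (structureConstants b₁ b₂) l ≠ 0 ∧
      structureForm (structureConstants b₁ b₂) l x = 0 ∧
      (∀ m, structureForm (structureConstants b₁ b₂) l (w m) = 0) ∧
      (∀ m, structureForm (structureConstants b₁ b₂) l (v m) = 0) ∧
      CarnotGroup.log S p = ∑ i, x i • (b₁ i : g) +
        ∑ k, (∑ m, structureMap (structureConstants b₁ b₂) ℝ (w m) (v m)) k • (b₂ k : g) := by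
  obtain ⟨γ, hγ, rfl⟩ := hp
  obtain ⟨f, ⟨z₀, hz₀, hfz₀⟩, x, hx, z, hz, hxz⟩ := exists_radical_of_isAbnormal hγ
  obtain ⟨w, v, hw, hv, rfl⟩ := exists_sum_lie_of_mem_span b₁ (W := S.radical f) (fun a ha => ha.1) hz
  obtain ⟨i₀, hi₀⟩ : ∃ i₀, f (b₂ i₀) ≠ 0 := by
    by_contra! h
    refine hfz₀ ?_
    rw [← sum_repr_smul b₂ hz₀, map_sum]
    exact Finset.sum_eq_zero fun i _ => by rw [map_smul, h i, smul_zero]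
  refine ⟨i₀, fun k => (f (b₂ i₀))⁻¹ * f (b₂ k), b₁.repr ⟨x, hx.1⟩,
    fun m => b₁.repr ⟨w m, (hw m).1⟩, fun m => b₁.repr ⟨v m, (hv m).1⟩, inv_mul_cancel₀ hi₀, ?_,
    structureForm_repr_eq_zero b₁ b₂ hx _, fun m => structureForm_repr_eq_zero b₁ b₂ (hw m) _,
    fun m => structureForm_repr_eq_zero b₁ b₂ (hv m) _, ?_⟩
  · intro h0
    refine hfz₀ ?_
    -- V₂ is spanned by brackets, so a zero form would make f vanish on V₂.
    have hle : S.V₂ ≤ LinearMap.ker f := by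
      rw [← S.span_lie, Submodule.span_le]
      rintro _ ⟨a, ha, b, hb, rfl⟩
      have h1 := apply_lie_sum_smul b₁ b₂ f (b₁.repr ⟨a, ha⟩) (b₁.repr ⟨b, hb⟩)
      have h2 := LinearMap.congr_fun (LinearMap.congr_fun h0 (b₁.repr ⟨a, ha⟩)) (b₁.repr ⟨b, hb⟩)
      rw [structureForm_apply] at h1 h2
      simp only [mul_assoc, ← Finset.mul_sum] at h2
      rw [← h1, sum_repr_smul, sum_repr_smul] at h2
      exact (mul_eq_zero.1 h2).resolve_left (inv_ne_zero hi₀)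
    exact hle hz₀
  · rw [hxz, sum_repr_smul b₁ hx.1]
    congr 1
    simp only [Finset.sum_apply, Finset.sum_smul]
    rw [Finset.sum_comm]
    refine Finset.sum_congr rfl fun m _ => ?_
    rw [← lie_sum_smul b₁ b₂, sum_repr_smul, sum_repr_smul]

end

end StepTwoStratification

/-! ### The codimension of the abnormal set -/

/-! ### Transfer of pointwise relations from the ring of functions to a field. -/

section Transfer

variable {X K : Type*} [Field K] [Algebra ℝ K] (φ : (X → ℝ) →ₐ[ℝ] K) {r s : ℕ}
  (c : Fin r → Fin r → Fin s → ℝ)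

lemma structureMap_transfer (x y : X → Fin r → ℝ) (k : Fin s) :
    structureMap c K (fun i => φ fun a => x a i) (fun i => φ fun a => y a i) k =
      φ fun a => structureMap c ℝ (x a) (y a) k := by
  have h : (fun a => structureMap c ℝ (x a) (y a) k) = ∑ i, ∑ j,
      (fun a => x a i) * (fun a => y a j) * algebraMap ℝ (X → ℝ) (c i j k) := by
    ext a
    simp [structureMap_apply]
  rw [h]
  simp [structureMap_apply]

lemma structureForm_transfer (l : X → Fin s → ℝ) (x y : X → Fin r → ℝ) :
    structureForm c (fun k => φ fun a => l a k) (fun i => φ fun a => x a i)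
      (fun i => φ fun a => y a i) = φ fun a => structureForm c (l a) (x a) (y a) := by
  have h : (fun a => structureForm c (l a) (x a) (y a)) = ∑ k, (fun a => l a k) *
      (fun a => structureMap c ℝ (x a) (y a) k) := by
    ext a
    simp [structureForm_apply]
  rw [h, structureForm_apply]
  simp [structureMap_transfer]

lemma single_transfer (i : Fin r) :
    (Pi.single i 1 : Fin r → K) = fun j => φ fun _ => (Pi.single i 1 : Fin r → ℝ) j := by
  ext j
  by_cases h : j = i
  · subst h
    simp only [Pi.single_eq_same]
    exact (map_one φ).symm
  · simp only [Pi.single_eq_of_ne h]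
    exact (map_zero φ).symm

lemma structureForm_eq_zero_transfer {l : X → Fin s → ℝ} {x : X → Fin r → ℝ}
    (h : ∀ a, structureForm c (l a) (x a) = 0) :
    structureForm c (fun k => φ fun a => l a k) (fun i => φ fun a => x a i) = 0 := by
  refine (Pi.basisFun K (Fin r)).ext fun j => ?_
  rw [Pi.basisFun_apply, single_transfer φ, structureForm_transfer]
  simp only [h, LinearMap.zero_apply]
  exact map_zero φ

/-- The nonzero entry depends on the point, and a nonzero function may map to 0. The sum of the
squares of all entries vanishes nowhere, so it is a unit among the functions and its image is
nonzero. -/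
lemma structureForm_ne_zero_transfer {l : X → Fin s → ℝ} (h : ∀ a, structureForm c (l a) ≠ 0) :
    structureForm c (fun k => φ fun a => l a k) ≠ 0 := by
  intro h0
  let e : Fin r → Fin r → X → ℝ := fun i j a =>
    structureForm c (l a) (Pi.single i 1) (Pi.single j 1)
  have he (i j : Fin r) : φ (e i j) = 0 := by
    have h1 := structureForm_transfer φ c l (fun _ => Pi.single i 1) (fun _ => Pi.single j 1)
    rw [h0] at h1
    exact h1.symm
  let q : X → ℝ := ∑ i, ∑ j, e i j * e i j
  have hq (a : X) : q a ≠ 0 := by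
    intro hqa
    refine h a ((Pi.basisFun ℝ (Fin r)).ext fun i => (Pi.basisFun ℝ (Fin r)).ext fun j => ?_)
    simp only [q, Finset.sum_apply, Pi.mul_apply] at hqa
    have h1 := (Finset.sum_eq_zero_iff_of_nonneg fun i _ =>
      Finset.sum_nonneg fun j _ => mul_self_nonneg _).1 hqa i (Finset.mem_univ i)
    have h2 := (Finset.sum_eq_zero_iff_of_nonneg fun j _ => mul_self_nonneg _).1 h1 j
      (Finset.mem_univ j)
    simpa [e] using h2
  have h1 : q * q⁻¹ = 1 := by
    ext a
    exact mul_inv_cancel₀ (hq a)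
  have h2 : φ q = 0 := by simp [q, he]
  have h3 := congrArg φ h1
  rw [map_mul, h2, zero_mul, map_one] at h3
  exact zero_ne_one h3

/-- The index depends on the point, but the product of all lᵢ − 1 is the zero function, and K is a
domain. -/
lemma exists_eq_one_transfer {l : X → Fin s → ℝ} (h : ∀ a, ∃ i, l a i = 1) :
    ∃ i, φ (fun a => l a i) = 1 := by
  have h1 : ∏ i, ((fun a => l a i) - 1 : X → ℝ) = 0 := by
    ext a
    obtain ⟨i, hi⟩ := h a
    rw [Finset.prod_apply]
    exact Finset.prod_eq_zero (Finset.mem_univ i) (by simp [hi])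
  have h2 := congrArg φ h1
  rw [map_prod, map_zero, Finset.prod_eq_zero_iff] at h2
  obtain ⟨i, -, hi⟩ := h2
  exact ⟨i, by rwa [map_sub, map_one, sub_eq_zero] at hi⟩

end Transfer

namespace StepTwoStratification

/-- Two vectors of V₁ with nonzero bracket are independent, and V₂ ≠ 0. This makes the
codimension-three bound n − 3 a natural number. -/
lemma three_le_finrank {g : Type*} [LieRing g] [LieAlgebra ℝ g] [FiniteDimensional ℝ g]
    (S : StepTwoStratification g) : 3 ≤ Module.finrank ℝ g := by
  have hrs := Submodule.finrank_add_eq_of_isCompl S.isCompl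
  have h2 : Module.finrank ℝ S.V₂ ≠ 0 := fun h => S.V₂_ne_bot (Submodule.finrank_eq_zero.1 h)
  obtain ⟨a, ha, b, hb, hab⟩ : ∃ a ∈ S.V₁, ∃ b ∈ S.V₁, ⁅a, b⁆ ≠ 0 := by
    by_contra! h
    refine S.V₂_ne_bot ?_
    rw [← S.span_lie, Submodule.span_eq_bot]
    rintro _ ⟨a, ha, b, hb, rfl⟩
    exact h a ha b hb
  have hli : LinearIndependent ℝ ![(⟨a, ha⟩ : S.V₁), ⟨b, hb⟩] := by
    rw [LinearIndependent.pair_iff]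
    intro s t hst
    have h0 : s • a + t • b = 0 := congrArg S.V₁.subtype hst
    have hs := congrArg (fun z => ⁅z, b⁆) h0
    have ht := congrArg (fun z => ⁅a, z⁆) h0
    simp only [add_lie, lie_add, smul_lie, lie_smul, lie_self, smul_zero, add_zero, zero_add,
      zero_lie, lie_zero, smul_eq_zero, hab, or_false] at hs ht
    exact ⟨hs, ht⟩
  have h1 := hli.fintype_card_le_finrank
  rw [Fintype.card_fin] at h1
  omega

variable {g : Type*} [NormedRealLieAlgebra g] [FiniteDimensional ℝ g] (S : StepTwoStratification g)

/-- The Zariski closure of the abnormal set has codimension at least three. -/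
theorem ringKrullDim_abnormalSet_le (hdim : Module.finrank ℝ g ≤ 7) {n d : ℕ} (hd : d + 3 = n)
    (b : Module.Basis (Fin n) ℝ g) :
    ringKrullDim (MvPolynomial (Fin n) ℝ ⧸
      MvPolynomial.vanishingIdeal ℝ (S.expCoord b '' S.abnormalSet)) ≤ d := by
  refine ringKrullDim_quotient_vanishingIdeal_le _ fun K _ _ φ => ?_
  have hn : n = Module.finrank ℝ g := by simp [Module.finrank_eq_card_basis b]
  have hrs := Submodule.finrank_add_eq_of_isCompl S.isCompl
  let b₁ := Module.finBasis ℝ S.V₁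
  let b₂ := Module.finBasis ℝ S.V₂
  have hpt (a : S.expCoord b '' S.abnormalSet) := a.2
  choose p hp hpa using hpt
  -- Arbitrary choices at each point; each coordinate becomes an element of the ring of functions
  -- and thus has an image in K.
  choose i₀ l x w v hl hne hx hw hv hlog using fun a =>
    exists_structureForm_of_mem_abnormalSet b₁ b₂ (hp a)
  obtain ⟨i, hi⟩ := exists_eq_one_transfer φ (l := l) fun a => ⟨i₀ a, hl a⟩
  obtain ⟨T, hT, hxT, hzT⟩ := exists_finset_card_add_three_le (by omega)
    (structureConstants_swap b₁ b₂) hi (structureForm_ne_zero_transfer φ _ hne)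
    (structureForm_eq_zero_transfer φ _ hx)
    (fun m => structureForm_eq_zero_transfer φ _ (fun a => hw a m))
    (fun m => structureForm_eq_zero_transfer φ _ (fun a => hv a m))
  refine ⟨T, by omega, fun j => ?_⟩
  have hcoord : (fun a : S.expCoord b '' S.abnormalSet => a.1 j) =
      ∑ i, (fun a => x a i) * algebraMap ℝ _ (b.repr (b₁ i) j) +
      ∑ k, (∑ m, fun a => structureMap (structureConstants b₁ b₂) ℝ (w a m) (v a m) k) *
        algebraMap ℝ _ (b.repr (b₂ k) j) := by
    ext a
    rw [← hpa a]
    simp [expCoord, hlog]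
  rw [hcoord]
  simp only [map_add, map_sum, map_mul, AlgHom.commutes]
  refine add_mem (sum_mem fun i _ => mul_mem (hxT i) (algebraMap_mem _ _))
    (sum_mem fun k _ => mul_mem ?_ (algebraMap_mem _ _))
  have := hzT k
  simpa only [Finset.sum_apply, structureMap_transfer] using this

end StepTwoStratification

theorem mainTheorem6 {g : Type*} [NormedRealLieAlgebra g] [FiniteDimensional ℝ g]
    (S : StepTwoStratification g) (hdim : Module.finrank ℝ g ≤ 7)
    {n : ℕ} (b : Module.Basis (Fin n) ℝ g) :
    ∃ Z : Set (Fin n → ℝ), IsRealAlgebraicSet Z ∧ realAlgebraicDim Z + 3 ≤ n ∧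
      S.expCoord b '' S.abnormalSet ⊆ Z := by
  -- Z is the Zariski closure of the abnormal set, which has the same vanishing ideal as the set.
  refine ⟨_, ⟨MvPolynomial.vanishingIdeal ℝ (S.expCoord b '' S.abnormalSet), rfl⟩, ?_,
    MvPolynomial.zeroLocus_vanishingIdeal_le _⟩
  have hcl : MvPolynomial.vanishingIdeal ℝ (MvPolynomial.zeroLocus ℝ
      (MvPolynomial.vanishingIdeal ℝ (S.expCoord b '' S.abnormalSet))) =
      MvPolynomial.vanishingIdeal ℝ (S.expCoord b '' S.abnormalSet) :=
    le_antisymm (MvPolynomial.vanishingIdeal_anti_mono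
      (MvPolynomial.zeroLocus_vanishingIdeal_le _))
      (MvPolynomial.le_vanishingIdeal_zeroLocus _)
  have hn : n = Module.finrank ℝ g := by simp [Module.finrank_eq_card_basis b]
  obtain ⟨d, hd⟩ := Nat.exists_eq_add_of_le' (hn ▸ S.three_le_finrank)
  have hcast : (n : WithBot ℕ∞) = d + 3 := by rw [hd]; push_cast; rfl
  rw [realAlgebraicDim, hcl, hcast]
  exact add_le_add_left (S.ringKrullDim_abnormalSet_le hdim hd.symm b) 3
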